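/- **Theorem 3.1 (estimating the proportion with known null $N(0,1)$).** Let $\varphi$ be the $N(0,1)$ density, and $M_q=E|Z|^q$ for $Z\sim N(0,1)$. Fix $\gamma\in(0,1/2)$, $\alpha>0$, $\beta\in[0,1/2)$, $\varepsilon_0\in(0,1)$, $q\ge 2$, $A>\sqrt2\,M_q^{1/q}$, and a function $T:\mathbb R\to\mathbb R$. For $n\ge1$ let $\tilde{\mathcal F}=\tilde{\mathcal F}(\alpha,\beta,\varepsilon_0,q,A;n)$ be the set of all densities $$f(x)=(1-\varepsilon)\varphi(x)+\varepsilon\int\frac1\sigma\,\varphi\Big(\frac{x-u}{\sigma}\Big)\,dH(u,\sigma)$$ such that: 1. $0\le\varepsilon\le\varepsilon_0n^{-\beta}$ and $\int|x|^qf(x)\,dx\le A^q$; 2. $H$ is a probability measure whose $\sigma$-marginal is supported on $[1,\infty)$, and the conditional law of $u$ given $\sigma$ has a density $h(\cdot\,|\,\sigma)$ for every $\sigma\ge1$; 3. with $\hat h(t|\sigma)=\int e^{itu}h(u|\sigma)\,du$, $$\limsup_{t\to\infty}\ \sup_{\sigma\ge1}|t|^{\alpha}|\hat h(t|\sigma)|\le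 A$$ uniformly over the class, in the sense that for every $\delta>0$, every $t\ge T(\delta)$ and every $\sigma\ge 1$ one has $|t|^\alpha|\hat h(t|\sigma)|\le A+\delta$. Let $\tilde{\mathcal F}'\subset\tilde{\mathcal F}$ be the smaller class in which, in addition, for every $\delta>0$, every $t\ge T(\delta)$ and every $\sigma\ge1$, the derivative $\hat h'(t|\sigma)$ in $t$ exists and $|t|^{\alpha+1}|\hat h'(t|\sigma)|\le A+\delta$. Let $X_1,\dots,X_n$ be i.i.d. with density $f$, let $$R_n(\mathcal G)=\inf_{\hat\varepsilon}\sup_{f\in\mathcal G}E(\hat\varepsilon-\varepsilon)^2,$$ where the infimum is over all measurable functions $\hat\varepsilon$ of $X_1,\dots,X_n$, and let $$\hat\varepsilon_n(\gamma)=1-n^{-(1-\gamma)}\sum_{j=1}^n\cos\big(\sqrt{2\gamma\log n}\,X_j\big).$$ Then for $\mathcal G=\tilde{\mathcal F}$, and also for $\mathcal G=\tilde{\mathcal F}'$, there are constants $c,C,K>0$ depending only on $\alpha,\beta,\varepsilon_0,q,A,\gamma$ and $T$ such that for all sufficiently large $n$ $$R_n(\mathcal G)\ \ge\ c\,n^{-2\beta}(\log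 n)^{-\alpha},\qquad \sup_{f\in\mathcal G}E\big(\hat\varepsilon_n(\gamma)-\varepsilon\big)^2\ \le\ C\big(n^{-2\beta}(\log n)^{-\alpha}+n^{2\gamma-1}\big).$$ In particular, if $\gamma<1/2-\beta$, then $\hat\varepsilon_n(\gamma)$ attains the optimal rate of convergence: for all sufficiently large $n$, $$\sup_{f\in\mathcal G}E\big(\hat\varepsilon_n(\gamma)-\varepsilon\big)^2\le K\,n^{-2\beta}(\log n)^{-\alpha}\quad\text{and}\quad \sup_{f\in\mathcal G}E\big(\hat\varepsilon_n(\gamma)-\varepsilon\big)^2\le K\,R_n(\mathcal G).$$ -/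

import Mathlib

open MeasureTheory ProbabilityTheory Filter
open scoped ENNReal

noncomputable section

namespace ProportionEstimation

/-- The standard normal density `φ`. -/
def stdPhi (x : ℝ) : ℝ := gaussianPDFReal 0 1 x

/-- `M_q = E|Z|^q` for `Z ∼ N(0,1)`. -/
def absMoment (q : ℝ) : ℝ := ∫ x : ℝ, |x| ^ q ∂(gaussianReal 0 1)

/-- `H` is the joint law of `(u, σ)`: a probability measure whose `σ`-marginal is supported on
`[1, ∞)` and whose conditional law of `u` given `σ` has the density `u ↦ h u σ`
(a genuine probability density for every `σ ≥ 1`). -/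
structure IsMixingLaw (H : Measure (ℝ × ℝ)) (h : ℝ → ℝ → ℝ) : Prop where
  prob : IsProbabilityMeasure H
  support : H.snd (Set.Iio 1) = 0
  measurable : Measurable (Function.uncurry h)
  nonneg : ∀ u σ, 0 ≤ h u σ
  density : ∀ σ, 1 ≤ σ → ∫⁻ u, ENNReal.ofReal (h u σ) = 1
  disintegration :
    H = ((volume : Measure ℝ).prod H.snd).withDensity (fun p => ENNReal.ofReal (h p.1 p.2))

/-- The Gaussian mixture density with null component `N(0,1)`, proportion `ε` and mixing law `H`:
`(1 - ε) φ(x) + ε ∫ σ⁻¹ φ((x - u)/σ) dH(u, σ)`. -/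
def mixtureDensity (ε : ℝ) (H : Measure (ℝ × ℝ)) (x : ℝ) : ℝ :=
  (1 - ε) * stdPhi x + ε * ∫ p : ℝ × ℝ, p.2⁻¹ * stdPhi ((x - p.1) / p.2) ∂H

/-- The conditional characteristic function `ĥ(t|σ) = ∫ e^{itu} h(u|σ) du`. -/
def condCharFun (h : ℝ → ℝ → ℝ) (σ t : ℝ) : ℂ :=
  ∫ u : ℝ, Complex.exp (Complex.I * (t : ℂ) * (u : ℂ)) * (h u σ : ℂ)

/-- `limsup_{t → ∞} sup_{σ ≥ 1} |t|^α |ĥ(t|σ)| ≤ A`, with the threshold `T δ` beyond which the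
supremum is at most `A + δ` prescribed in advance (so that it is common to a whole class).
If `d = true`, the same is also required of `|t|^(α+1) |ĥ'(t|σ)|`. -/
def HasDecay (α A : ℝ) (T : ℝ → ℝ) (d : Bool) (h : ℝ → ℝ → ℝ) : Prop :=
  ∀ δ : ℝ, 0 < δ → ∀ t : ℝ, T δ ≤ t → ∀ σ : ℝ, 1 ≤ σ →
    |t| ^ α * ‖condCharFun h σ t‖ ≤ A + δ ∧
    (d = true → DifferentiableAt ℝ (condCharFun h σ) t ∧
      |t| ^ (α + 1) * ‖deriv (condCharFun h σ) t‖ ≤ A + δ)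

/-- The parameter space, as the set of all pairs `(ε, f)` of a proportion
`0 ≤ ε ≤ ε₀ n^{-β}` and a mixture density `f` with proportion `ε`. -/
def paramSpace (α β ε₀ q A : ℝ) (T : ℝ → ℝ) (d : Bool) (n : ℕ) : Set (ℝ × (ℝ → ℝ)) :=
  {p | 0 ≤ p.1 ∧ p.1 ≤ ε₀ * (n : ℝ) ^ (-β) ∧
    (∃ (H : Measure (ℝ × ℝ)) (h : ℝ → ℝ → ℝ),
      IsMixingLaw H h ∧ HasDecay α A T d h ∧ p.2 = mixtureDensity p.1 H) ∧
    ∫⁻ x : ℝ, ENNReal.ofReal (|x| ^ q * p.2 x) ≤ ENNReal.ofReal (A ^ q)}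

/-- The law of an i.i.d. sample `(X_1, …, X_n)` from the density `f`. -/
def sampleLaw (n : ℕ) (f : ℝ → ℝ) : Measure (Fin n → ℝ) :=
  Measure.pi (fun _ => (volume : Measure ℝ).withDensity (fun x => ENNReal.ofReal (f x)))

/-- Mean squared error `E_f[(est(X_1, …, X_n) - ε)²]`. -/
def mse {n : ℕ} (est : (Fin n → ℝ) → ℝ) (ε : ℝ) (f : ℝ → ℝ) : ℝ≥0∞ :=
  ∫⁻ X, ENNReal.ofReal ((est X - ε) ^ 2) ∂(sampleLaw n f)

/-- Worst-case mean squared error over a class. -/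
def maxRisk {n : ℕ} (est : (Fin n → ℝ) → ℝ) (S : Set (ℝ × (ℝ → ℝ))) : ℝ≥0∞ :=
  ⨆ p ∈ S, mse est p.1 p.2

/-- The minimax mean squared error for the proportion over a class. -/
def minimaxRisk (n : ℕ) (S : Set (ℝ × (ℝ → ℝ))) : ℝ≥0∞ :=
  ⨅ (est : (Fin n → ℝ) → ℝ) (_ : Measurable est), maxRisk est S

/-- The estimator `1 - n^{-(1-γ)} ∑_j cos(√(2γ log n) X_j)`. -/
def propEstimator (γ : ℝ) (n : ℕ) (X : Fin n → ℝ) : ℝ :=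
  1 - (n : ℝ) ^ (-(1 - γ)) * ∑ j, Real.cos (Real.sqrt (2 * γ * Real.log n) * X j)

/-- The rate `n^{-2β} (log n)^{-α}`. -/
def rate (α β : ℝ) (n : ℕ) : ℝ := (n : ℝ) ^ (-2 * β) * Real.log n ^ (-α)

end ProportionEstimation

end

noncomputable section

namespace ProportionEstimation

/-! Upper bound. At frequency `t` the cosine moment of a mixture is `(1 - ε) e^{-t²/2}` plus `ε`
times the real part of the `σ`-average of `e^{-σ²t²/2} ĥ(t|σ)`. Since `σ ≥ 1`, the second term is at
most `ε e^{-t²/2} sup_σ |ĥ(t|σ)|`. At `t = √(2γ log n)` one has `e^{-t²/2} = n^{-γ}`; multiplying by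
`n^γ` leaves a bias of order `n^{-β} t^{-α}`, that is `n^{-β} (log n)^{-α/2}`, while averaging `n`
bounded cosines costs a variance of at most `n^{2γ-1}`.

Lower bound. Le Cam's method needs two points of the class whose proportions differ by order `n^{-β}
(log n)^{-α/2}` but whose densities are so close that `n` observations cannot separate them. Let `k`
be a kernel whose characteristic function equals one on `[-τ, τ]`. Convolved with `φ` it reproduces
`φ` up to `O(e^{-τ²/4})`, so mass may be moved from the null component to the alternative `k` almost
invisibly. With `s = θ τ^{-α}`, take `h₁ = (h₀ + s k)/(1 + s)` and `e₁ = (1 + s) e₀`; the two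
mixtures then differ by exactly `e₀ s (φ * k - φ)`. The choice `τ = 4 √(log n)` makes this
`O(n^{-4})`, while `e₁ - e₀ = e₀ s` has the required order.

The size of `s` is limited by two demands: `h₁` must be nonnegative and its characteristic function
must still decay like `|t|^{-α}`. Both allow `s` of order `τ^{-α}` when `h₀` is a scale mixture of
centred normals with variance weight of order `v^{α/2-1}` at zero: Gamma integrals give the decay of
`ĥ₀` and `ĥ₀'`, and a polynomial lower bound on `h₀` dominates `s |k|` because `k` decreases rapidly
(`exists_base_density`, `scaled_kernel_le`, `exists_perturbation`). The decay bounds hold at every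
`t`, hence for any threshold `T` and in both classes at once. -/

/-! ### Normal densities and their characteristic functions -/

theorem stdPhi_nonneg (x : ℝ) : 0 ≤ stdPhi x := gaussianPDFReal_nonneg 0 1 x

@[fun_prop]
theorem measurable_stdPhi : Measurable stdPhi := measurable_gaussianPDFReal 0 1

theorem integrable_stdPhi : Integrable stdPhi := integrable_gaussianPDFReal 0 1

theorem stdPhi_eq (x : ℝ) : stdPhi x = (√(2 * Real.pi))⁻¹ * Real.exp (-x ^ 2 / 2) := by
  simp [stdPhi, gaussianPDFReal]

theorem stdPhi_le_one (x : ℝ) : stdPhi x ≤ 1 := by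
  rw [stdPhi_eq]
  have h1 : 1 ≤ √(2 * Real.pi) := by
    rw [Real.one_le_sqrt]; nlinarith [Real.pi_gt_three]
  have h2 : Real.exp (-x ^ 2 / 2) ≤ 1 := by
    rw [Real.exp_le_one_iff]; nlinarith [sq_nonneg x]
  exact mul_le_one₀ (inv_le_one_of_one_le₀ h1) (Real.exp_nonneg _) h2

/-- The component density `σ⁻¹ φ((x - u)/σ)`, as a function of `(u, σ)` and `x`. -/
def component (p : ℝ × ℝ) (x : ℝ) : ℝ := p.2⁻¹ * stdPhi ((x - p.1) / p.2)

@[fun_prop]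
theorem measurable_component : Measurable (Function.uncurry component) := by
  unfold component Function.uncurry; fun_prop

theorem component_eq {p : ℝ × ℝ} (hp : 0 < p.2) (x : ℝ) :
    component p x = gaussianPDFReal p.1 (Real.toNNReal (p.2 ^ 2)) x := by
  rw [component, stdPhi_eq, gaussianPDFReal, Real.coe_toNNReal _ (sq_nonneg _),
    Real.sqrt_mul (by positivity) (p.2 ^ 2), Real.sqrt_sq hp.le, mul_inv]
  have h : -((x - p.1) / p.2) ^ 2 / 2 = -(x - p.1) ^ 2 / (2 * p.2 ^ 2) := by
    field_simp
  rw [h]; ring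

theorem component_nonneg {p : ℝ × ℝ} (hp : 0 < p.2) (x : ℝ) : 0 ≤ component p x := by
  rw [component_eq hp]; exact gaussianPDFReal_nonneg _ _ _

theorem component_le_one {p : ℝ × ℝ} (hp : 1 ≤ p.2) (x : ℝ) : component p x ≤ 1 :=
  mul_le_one₀ (inv_le_one_of_one_le₀ hp) (stdPhi_nonneg _) (stdPhi_le_one _)

theorem toNNReal_sq_ne_zero {s : ℝ} (hs : 0 < s) : Real.toNNReal (s ^ 2) ≠ 0 := by
  simpa using hs.ne'

theorem integral_component {p : ℝ × ℝ} (hp : 0 < p.2) : ∫ x, component p x = 1 := by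
  simp_rw [component_eq hp]
  exact integral_gaussianPDFReal_eq_one _ (toNNReal_sq_ne_zero hp)

theorem integrable_component {p : ℝ × ℝ} (hp : 0 < p.2) : Integrable (component p) := by
  have : component p = gaussianPDFReal p.1 (Real.toNNReal (p.2 ^ 2)) :=
    funext fun x => component_eq hp x
  rw [this]; exact integrable_gaussianPDFReal _ _

/-- The characteristic function of a normal density. -/
theorem integral_exp_mul_gaussianPDFReal (m t : ℝ) {v : NNReal} (hv : v ≠ 0) :
    ∫ x : ℝ, Complex.exp (Complex.I * t * x) * (gaussianPDFReal m v x : ℂ) =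
      Complex.exp (Complex.I * t * m) * (Real.exp (-(v * t ^ 2 / 2)) : ℂ) := by
  have h := charFun_gaussianReal (μ := m) (v := v) t
  rw [charFun_apply_real, integral_gaussianReal_eq_integral_smul hv] at h
  rw [Complex.ofReal_exp, ← Complex.exp_add]
  calc ∫ x : ℝ, Complex.exp (Complex.I * t * x) * (gaussianPDFReal m v x : ℂ)
      = ∫ x : ℝ, gaussianPDFReal m v x • Complex.exp (t * x * Complex.I) := by
        congr 1; ext x; rw [Complex.real_smul, mul_comm]; congr 2; ring
    _ = _ := h
    _ = _ := by congr 1; push_cast; ring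

theorem integral_exp_mul_stdPhi (t : ℝ) :
    ∫ x : ℝ, Complex.exp (Complex.I * t * x) * (stdPhi x : ℂ) = (Real.exp (-(t ^ 2 / 2)) : ℂ) := by
  have := integral_exp_mul_gaussianPDFReal 0 t (v := 1) one_ne_zero
  simpa [stdPhi] using this

theorem integral_exp_mul_component {p : ℝ × ℝ} (hp : 0 < p.2) (t : ℝ) :
    ∫ x : ℝ, Complex.exp (Complex.I * t * x) * (component p x : ℂ) =
      Complex.exp (Complex.I * t * p.1) * (Real.exp (-(p.2 ^ 2 * t ^ 2 / 2)) : ℂ) := by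
  simp_rw [component_eq hp]
  rw [integral_exp_mul_gaussianPDFReal _ _ (toNNReal_sq_ne_zero hp),
    Real.coe_toNNReal _ (sq_nonneg _)]

theorem norm_exp_I_mul_mul (t x : ℝ) : ‖Complex.exp (Complex.I * t * x)‖ = 1 := by
  have : Complex.I * t * x = ((t * x : ℝ) : ℂ) * Complex.I := by push_cast; ring
  rw [this, Complex.norm_exp_ofReal_mul_I]

/-! ### Characteristic functions of mixtures -/

section Mixture

variable {H : Measure (ℝ × ℝ)} {h : ℝ → ℝ → ℝ} {ε : ℝ}

theorem IsMixingLaw.ae_snd (hH : IsMixingLaw H h) : ∀ᵐ σ ∂H.snd, 1 ≤ σ := by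
  have := hH.support
  rw [ae_iff]
  simpa [Set.Iio] using this

theorem IsMixingLaw.ae_le (hH : IsMixingLaw H h) : ∀ᵐ p ∂H, 1 ≤ p.2 := by
  have h1 := hH.ae_snd
  rw [Measure.snd] at h1
  exact ae_of_ae_map measurable_snd.aemeasurable h1

theorem IsMixingLaw.integrable_component (hH : IsMixingLaw H h) (x : ℝ) :
    Integrable (fun p => component p x) H := by
  have := hH.prob
  refine (integrable_const (1 : ℝ)).mono' ?_ ?_
  · exact (measurable_component.comp (by fun_prop : Measurable fun p : ℝ × ℝ => (p, x))
      ).aestronglyMeasurable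
  · filter_upwards [hH.ae_le] with p hp
    rw [Real.norm_of_nonneg (component_nonneg (by linarith) x)]
    exact component_le_one hp x

/-- Every component has mass one and `H` is a probability, so the joint integral is one. This
licenses Fubini between `x` and the mixing parameters. -/
theorem IsMixingLaw.integrable_prod (hH : IsMixingLaw H h) :
    Integrable (fun z : ℝ × (ℝ × ℝ) => component z.2 z.1) (volume.prod H) := by
  have := hH.prob
  have hm : AEStronglyMeasurable (fun z : ℝ × (ℝ × ℝ) => component z.2 z.1) (volume.prod H) :=
    (measurable_component.comp (by fun_prop : Measurable fun z : ℝ × (ℝ × ℝ) => (z.2, z.1))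
      ).aestronglyMeasurable
  rw [integrable_prod_iff' hm]
  constructor
  · filter_upwards [hH.ae_le] with p hp
    exact ProportionEstimation.integrable_component (by linarith)
  · refine (integrable_const (1 : ℝ)).congr ?_
    filter_upwards [hH.ae_le] with p hp
    have hp0 : 0 < p.2 := by linarith
    simp_rw [Real.norm_of_nonneg (component_nonneg hp0 _)]
    exact (integral_component hp0).symm

theorem mixtureDensity_eq (x : ℝ) :
    mixtureDensity ε H x = (1 - ε) * stdPhi x + ε * ∫ p, component p x ∂H := rfl

theorem IsMixingLaw.integral_component_nonneg (hH : IsMixingLaw H h) (x : ℝ) :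
    0 ≤ ∫ p, component p x ∂H := by
  refine integral_nonneg_of_ae ?_
  filter_upwards [hH.ae_le] with p hp
  exact component_nonneg (by linarith) x

theorem IsMixingLaw.mixtureDensity_nonneg (hH : IsMixingLaw H h) (h0 : 0 ≤ ε) (h1 : ε ≤ 1)
    (x : ℝ) : 0 ≤ mixtureDensity ε H x := by
  rw [mixtureDensity_eq]
  exact add_nonneg (mul_nonneg (by linarith) (stdPhi_nonneg x))
    (mul_nonneg h0 (hH.integral_component_nonneg x))

theorem IsMixingLaw.integrable_integral_component (hH : IsMixingLaw H h) :
    Integrable (fun x => ∫ p, component p x ∂H) := by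
  have := hH.prob
  exact hH.integrable_prod.integral_prod_left

theorem IsMixingLaw.integrable_mixtureDensity (hH : IsMixingLaw H h) :
    Integrable (mixtureDensity ε H) := by
  have : mixtureDensity ε H = fun x => (1 - ε) * stdPhi x + ε * ∫ p, component p x ∂H :=
    funext fun x => mixtureDensity_eq x
  rw [this]
  exact (integrable_stdPhi.const_mul _).add (hH.integrable_integral_component.const_mul _)

/-- The characteristic function of a mixture density, in terms of the mixing law. -/
theorem IsMixingLaw.integral_exp_mul_mixtureDensity (hH : IsMixingLaw H h) (t : ℝ) :
    ∫ x : ℝ, Complex.exp (Complex.I * t * x) * (mixtureDensity ε H x : ℂ) =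
      (1 - ε) * (Real.exp (-(t ^ 2 / 2)) : ℂ) +
        ε * ∫ p, Complex.exp (Complex.I * t * p.1) * (Real.exp (-(p.2 ^ 2 * t ^ 2 / 2)) : ℂ) ∂H := by
  have := hH.prob
  have hexp : Continuous fun x : ℝ => Complex.exp (Complex.I * t * x) := by fun_prop
  have hi1 : Integrable fun x : ℝ => Complex.exp (Complex.I * t * x) * (stdPhi x : ℂ) :=
    integrable_stdPhi.ofReal.bdd_mul (c := 1) hexp.aestronglyMeasurable
      (ae_of_all _ fun x => (norm_exp_I_mul_mul t x).le)
  have hi2 : Integrable fun x : ℝ =>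
      Complex.exp (Complex.I * t * x) * ((∫ p, component p x ∂H : ℝ) : ℂ) :=
    hH.integrable_integral_component.ofReal.bdd_mul (c := 1) hexp.aestronglyMeasurable
      (ae_of_all _ fun x => (norm_exp_I_mul_mul t x).le)
  have hi3 : Integrable (fun z : ℝ × (ℝ × ℝ) =>
      Complex.exp (Complex.I * t * z.1) * (component z.2 z.1 : ℂ)) (volume.prod H) :=
    hH.integrable_prod.ofReal.bdd_mul (c := 1)
      (by fun_prop) (ae_of_all _ fun z => (norm_exp_I_mul_mul t z.1).le)
  have hsplit : ∀ x : ℝ, Complex.exp (Complex.I * t * x) * (mixtureDensity ε H x : ℂ) =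
      (1 - ε) * (Complex.exp (Complex.I * t * x) * (stdPhi x : ℂ)) +
      ε * (Complex.exp (Complex.I * t * x) * ((∫ p, component p x ∂H : ℝ) : ℂ)) := by
    intro x; rw [mixtureDensity_eq]; push_cast; ring
  simp_rw [hsplit]
  rw [integral_add (hi1.const_mul _) (hi2.const_mul _), integral_const_mul, integral_const_mul,
    integral_exp_mul_stdPhi]
  congr 2
  calc ∫ x : ℝ, Complex.exp (Complex.I * t * x) * ((∫ p, component p x ∂H : ℝ) : ℂ)
      = ∫ x : ℝ, ∫ p : ℝ × ℝ, Complex.exp (Complex.I * t * x) * (component p x : ℂ) ∂H := by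
        congr 1; ext x; rw [integral_const_mul, integral_complex_ofReal]
    _ = ∫ p : ℝ × ℝ, (∫ x : ℝ, Complex.exp (Complex.I * t * x) * (component p x : ℂ)) ∂H :=
        integral_integral_swap (f := fun (x : ℝ) (p : ℝ × ℝ) =>
          Complex.exp (Complex.I * t * x) * (component p x : ℂ)) hi3
    _ = _ := by
        refine integral_congr_ae ?_
        filter_upwards [hH.ae_le] with p hp
        exact integral_exp_mul_component (by linarith) t

/-- The total mass is read off from the characteristic function at zero. -/
theorem IsMixingLaw.integral_mixtureDensity (hH : IsMixingLaw H h) :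
    ∫ x, mixtureDensity ε H x = 1 := by
  have := hH.prob
  have h0 := hH.integral_exp_mul_mixtureDensity (ε := ε) 0
  simp only [Complex.ofReal_zero, mul_zero, zero_mul, Complex.exp_zero, one_mul] at h0
  rw [integral_complex_ofReal] at h0
  simp at h0
  exact_mod_cast h0

theorem IsMixingLaw.lintegral_mixtureDensity (hH : IsMixingLaw H h) (h0 : 0 ≤ ε) (h1 : ε ≤ 1) :
    ∫⁻ x, ENNReal.ofReal (mixtureDensity ε H x) = 1 := by
  rw [← ofReal_integral_eq_lintegral_ofReal hH.integrable_mixtureDensity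
    (ae_of_all _ (hH.mixtureDensity_nonneg h0 h1)), hH.integral_mixtureDensity, ENNReal.ofReal_one]

/-- Integration against the mixing law by conditioning on `σ`. -/
theorem IsMixingLaw.integral_exp_eq (hH : IsMixingLaw H h) (t : ℝ) :
    ∫ p, Complex.exp (Complex.I * t * p.1) * (Real.exp (-(p.2 ^ 2 * t ^ 2 / 2)) : ℂ) ∂H =
      ∫ σ, (Real.exp (-(σ ^ 2 * t ^ 2 / 2)) : ℂ) * condCharFun h σ t ∂H.snd := by
  have := hH.prob
  have hd : Measurable fun p : ℝ × ℝ => ENNReal.ofReal (h p.1 p.2) :=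
    hH.measurable.ennreal_ofReal
  set g : ℝ × ℝ → ℂ := fun p =>
    Complex.exp (Complex.I * t * p.1) * (Real.exp (-(p.2 ^ 2 * t ^ 2 / 2)) : ℂ) with hg
  have hgc : Continuous g := by
    rw [hg]; fun_prop
  have hgb : ∀ p, ‖g p‖ ≤ 1 := by
    intro p
    simp only [hg]
    rw [norm_mul, norm_exp_I_mul_mul, one_mul, Complex.norm_real,
      Real.norm_of_nonneg (Real.exp_nonneg _), Real.exp_le_one_iff]
    have : 0 ≤ p.2 ^ 2 * t ^ 2 := by positivity
    linarith
  have hgi : Integrable g H :=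
    (integrable_const (1 : ℝ)).mono' hgc.aestronglyMeasurable (ae_of_all _ hgb)
  have hfin : ∀ᵐ p ∂((volume : Measure ℝ).prod H.snd), ENNReal.ofReal (h p.1 p.2) < ∞ :=
    ae_of_all _ fun p => ENNReal.ofReal_lt_top
  have e1 : ∫ p, g p ∂H = ∫ p, h p.1 p.2 • g p ∂((volume : Measure ℝ).prod H.snd) := by
    conv_lhs => rw [hH.disintegration]
    rw [integral_withDensity_eq_integral_toReal_smul hd hfin]
    congr 1; ext p; rw [ENNReal.toReal_ofReal (hH.nonneg _ _)]
  have hi : Integrable (fun p : ℝ × ℝ => h p.1 p.2 • g p) ((volume : Measure ℝ).prod H.snd) := by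
    have h2 := hgi
    rw [hH.disintegration, integrable_withDensity_iff_integrable_smul' hd hfin] at h2
    refine h2.congr (ae_of_all _ fun p => ?_)
    simp only
    rw [ENNReal.toReal_ofReal (hH.nonneg _ _)]
  rw [e1, integral_prod_symm _ hi]
  congr 1; ext σ
  rw [condCharFun, ← integral_const_mul]
  congr 1; ext u
  simp only [hg, Complex.real_smul]; ring

/-- The support condition `σ ≥ 1` enters here: after conditioning on `σ`, the Gaussian factor
`e^{-σ²t²/2}` is at most the null factor `e^{-t²/2}`, so the alternative is no more visible at
frequency `t` than the null, up to the decay of `ĥ`. -/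
theorem IsMixingLaw.norm_integral_exp_le (hH : IsMixingLaw H h) {t B : ℝ}
    (hB : ∀ σ, 1 ≤ σ → ‖condCharFun h σ t‖ ≤ B) :
    ‖∫ p, Complex.exp (Complex.I * t * p.1) * (Real.exp (-(p.2 ^ 2 * t ^ 2 / 2)) : ℂ) ∂H‖ ≤
      Real.exp (-(t ^ 2 / 2)) * B := by
  have := hH.prob
  have hB0 : 0 ≤ B := (norm_nonneg _).trans (hB 1 le_rfl)
  rw [hH.integral_exp_eq]
  have := norm_integral_le_of_norm_le_const (μ := H.snd)
    (f := fun σ : ℝ => (Real.exp (-(σ ^ 2 * t ^ 2 / 2)) : ℂ) * condCharFun h σ t)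
    (C := Real.exp (-(t ^ 2 / 2)) * B) ?_
  · simpa using this
  filter_upwards [hH.ae_snd] with σ hσ
  rw [norm_mul, Complex.norm_real, Real.norm_of_nonneg (Real.exp_nonneg _)]
  gcongr
  · nlinarith [sq_nonneg t, sq_nonneg σ, mul_nonneg (sq_nonneg t) (by nlinarith : 0 ≤ σ ^ 2 - 1)]
  · exact hB σ hσ

/-- The cosine moment of a mixture deviates from `(1 - ε) e^{-t²/2}` by at most
`ε e^{-t²/2} sup_σ |ĥ(t|σ)|`. -/
theorem IsMixingLaw.abs_integral_cos_sub_le (hH : IsMixingLaw H h) (h0 : 0 ≤ ε) {t B : ℝ}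
    (hB : ∀ σ, 1 ≤ σ → ‖condCharFun h σ t‖ ≤ B) :
    |(∫ x, mixtureDensity ε H x * Real.cos (t * x)) - (1 - ε) * Real.exp (-(t ^ 2 / 2))| ≤
      ε * (Real.exp (-(t ^ 2 / 2)) * B) := by
  have h1 := hH.integral_exp_mul_mixtureDensity (ε := ε) t
  have hi : Integrable fun x : ℝ =>
      Complex.exp (Complex.I * t * x) * (mixtureDensity ε H x : ℂ) :=
    hH.integrable_mixtureDensity.ofReal.bdd_mul (c := 1)
      (by fun_prop) (ae_of_all _ fun x => (norm_exp_I_mul_mul t x).le)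
  have h2 : ∫ x, mixtureDensity ε H x * Real.cos (t * x) =
      (∫ x : ℝ, Complex.exp (Complex.I * t * x) * (mixtureDensity ε H x : ℂ)).re := by
    rw [← RCLike.re_eq_complex_re, ← integral_re hi]
    congr 1; ext x
    rw [RCLike.re_eq_complex_re, Complex.re_mul_ofReal]
    have : Complex.I * t * x = ((t * x : ℝ) : ℂ) * Complex.I := by push_cast; ring
    rw [this, Complex.exp_ofReal_mul_I_re, mul_comm]
  rw [h2, h1]
  set J := ∫ p, Complex.exp (Complex.I * t * p.1) *
    (Real.exp (-(p.2 ^ 2 * t ^ 2 / 2)) : ℂ) ∂H with hJ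
  have h3 : ((1 - (ε : ℂ)) * (Real.exp (-(t ^ 2 / 2)) : ℂ) + ε * J).re =
      (1 - ε) * Real.exp (-(t ^ 2 / 2)) + ε * J.re := by
    rw [Complex.add_re, Complex.re_ofReal_mul]
    congr 1
    have : (1 - (ε : ℂ)) * (Real.exp (-(t ^ 2 / 2)) : ℂ) =
      (((1 - ε) * Real.exp (-(t ^ 2 / 2)) : ℝ) : ℂ) := by push_cast; ring
    rw [this, Complex.ofReal_re]
  rw [h3, add_sub_cancel_left, abs_mul, abs_of_nonneg h0]
  gcongr
  exact (Complex.abs_re_le_norm J).trans (hH.norm_integral_exp_le hB)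

end Mixture

/-! ### Upper bound: bias and variance of the cosine estimator -/

/-- Bias-variance bound for the cosine estimator under an arbitrary density. -/
theorem mse_propEstimator_le {γ ε : ℝ} {n : ℕ} (hn : 1 ≤ n) {f : ℝ → ℝ} (hfm : Measurable f)
    (hf0 : ∀ x, 0 ≤ f x) (hf1 : ∫⁻ x, ENNReal.ofReal (f x) = 1) :
    mse (propEstimator γ n) ε f ≤
      ENNReal.ofReal ((1 - ε - (n : ℝ) ^ γ *
        ∫ x, f x * Real.cos (√(2 * γ * Real.log n) * x)) ^ 2 + (n : ℝ) ^ (2 * γ - 1)) := by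
  set t := √(2 * γ * Real.log n) with ht
  set ν : Measure ℝ := volume.withDensity fun x => ENNReal.ofReal (f x) with hν
  have hprob : IsProbabilityMeasure ν := ⟨by simp [hν, hf1]⟩
  set P : Measure (Fin n → ℝ) := Measure.pi fun _ => ν with hP
  set m := ∫ x, f x * Real.cos (t * x) with hm
  have hnpos : (0 : ℝ) < n := by exact_mod_cast hn
  set s := (n : ℝ) ^ (-(1 - γ)) with hs
  -- The normalisation `s` turns the sum of `n` cosines into `n^γ` times their average; `s ^ 2 * n`
  -- is the resulting bound on the variance.
  have hsn : s * n = (n : ℝ) ^ γ := by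
    rw [hs]
    nth_rw 2 [← Real.rpow_one (n : ℝ)]
    rw [← Real.rpow_add hnpos]; congr 1; ring
  have hsn2 : s ^ 2 * n = (n : ℝ) ^ (2 * γ - 1) := by
    rw [pow_two, mul_assoc, hsn, hs, ← Real.rpow_add hnpos]; congr 1; ring
  have hcos : Continuous fun x : ℝ => Real.cos (t * x) := by fun_prop
  have hYm : MemLp (fun x => Real.cos (t * x)) 2 ν :=
    MemLp.of_bound hcos.aestronglyMeasurable 1 (ae_of_all _ fun x => Real.abs_cos_le_one _)
  have hmean : ∫ x, Real.cos (t * x) ∂ν = m := by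
    rw [hν, integral_withDensity_eq_integral_toReal_smul hfm.ennreal_ofReal
      (ae_of_all _ fun _ => ENNReal.ofReal_lt_top)]
    congr 1; ext x
    rw [ENNReal.toReal_ofReal (hf0 x), smul_eq_mul]
  have hvarY : Var[fun x => Real.cos (t * x); ν] ≤ 1 := by
    refine (variance_le_expectation_sq hcos.aestronglyMeasurable).trans ?_
    have : ∫ x, (Real.cos (t * x)) ^ 2 ∂ν ≤ ∫ x, (1 : ℝ) ∂ν :=
      integral_mono hYm.integrable_sq (integrable_const _) fun x => Real.cos_sq_le_one _
    simpa using this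
  set W : (Fin n → ℝ) → ℝ := fun X => ∑ j, Real.cos (t * X j) with hW
  have hWsum : W = ∑ j, fun X : Fin n → ℝ => Real.cos (t * X j) := by ext X; simp [hW]
  have hWc : Continuous W := by rw [hW]; fun_prop
  have hWm : MemLp W 2 P := by
    refine MemLp.of_bound hWc.aestronglyMeasurable n (ae_of_all _ fun X => ?_)
    refine (Finset.abs_sum_le_sum_abs _ _).trans ?_
    calc ∑ j : Fin n, |Real.cos (t * X j)| ≤ ∑ j : Fin n, (1 : ℝ) :=
          Finset.sum_le_sum fun j _ => Real.abs_cos_le_one _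
      _ = n := by simp
  have hmeanW : ∫ X, W X ∂P = n * m := by
    rw [hW]
    rw [integral_finsetSum]
    · have : ∀ j : Fin n, ∫ X : Fin n → ℝ, Real.cos (t * X j) ∂P = m := fun j =>
        (integral_comp_eval (μ := fun _ : Fin n => ν) (i := j)
          (f := fun x => Real.cos (t * x)) hcos.aestronglyMeasurable).trans hmean
      simp [this]
    · intro j _
      refine (integrable_const (1 : ℝ)).mono'
        (hcos.comp (continuous_apply j)).aestronglyMeasurable (ae_of_all _ fun X => ?_)
      exact Real.abs_cos_le_one _
  have hvarW : Var[W; P] ≤ n := by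
    rw [hWsum, hP, variance_sum_pi (μ := fun _ : Fin n => ν)
      (X := fun _ x => Real.cos (t * x)) (fun _ => hYm)]
    calc ∑ _ : Fin n, Var[fun x => Real.cos (t * x); ν] ≤ ∑ _ : Fin n, (1 : ℝ) :=
          Finset.sum_le_sum fun _ _ => hvarY
      _ = n := by simp
  have hvar_eq : Var[W; P] = ∫ X, (W X - n * m) ^ 2 ∂P := by
    rw [variance_eq_integral hWm.1.aemeasurable, hmeanW]
  have hest : ∀ X, propEstimator γ n X - ε = (1 - ε - (n : ℝ) ^ γ * m) - s * (W X - n * m) := by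
    intro X; rw [propEstimator, ← hsn]; ring
  set b := 1 - ε - (n : ℝ) ^ γ * m with hb
  have hVi : Integrable (fun X => W X - n * m) P :=
    (hWm.integrable (by norm_num)).sub (integrable_const _)
  have hV2 : Integrable (fun X => (W X - n * m) ^ 2) P :=
    (hWm.sub (memLp_const _)).integrable_sq
  have hV0 : ∫ X, (W X - n * m) ∂P = 0 := by
    rw [integral_sub (hWm.integrable (by norm_num)) (integrable_const _), hmeanW]; simp
  have hexp : ∀ X, (propEstimator γ n X - ε) ^ 2 =
      b ^ 2 + (-2 * b * s) * (W X - n * m) + s ^ 2 * (W X - n * m) ^ 2 := by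
    intro X; rw [hest]; ring
  have hlin : Integrable (fun X => b ^ 2 + (-2 * b * s) * (W X - n * m)) P :=
    (integrable_const _).add (hVi.const_mul _)
  have hint : Integrable (fun X => (propEstimator γ n X - ε) ^ 2) P := by
    simp_rw [hexp]
    exact hlin.add (hV2.const_mul _)
  have hval : ∫ X, (propEstimator γ n X - ε) ^ 2 ∂P = b ^ 2 + s ^ 2 * Var[W; P] := by
    simp_rw [hexp]
    rw [integral_add hlin (hV2.const_mul _),
      integral_add (integrable_const _) (hVi.const_mul _), integral_const_mul,
      integral_const_mul, hV0, hvar_eq]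
    simp
  have : mse (propEstimator γ n) ε f =
      ENNReal.ofReal (∫ X, (propEstimator γ n X - ε) ^ 2 ∂P) :=
    (ofReal_integral_eq_lintegral_ofReal hint (ae_of_all _ fun X => sq_nonneg _)).symm
  rw [this, hval, ← hsn2]
  apply ENNReal.ofReal_le_ofReal
  gcongr

/-- The worst-case risk of the cosine estimator over the class. -/
theorem exists_maxRisk_propEstimator_le {γ α β ε₀ q A : ℝ} (hγ0 : 0 < γ)
    (hβ0 : 0 ≤ β) (hε0 : 0 < ε₀) (hε1 : ε₀ < 1) (hA : 0 < A) (T : ℝ → ℝ) (d : Bool) :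
    ∃ C : ℝ, 0 < C ∧ ∀ᶠ n : ℕ in atTop,
      maxRisk (propEstimator γ n) (paramSpace α β ε₀ q A T d n) ≤
        ENNReal.ofReal (C * (rate α β n + (n : ℝ) ^ (2 * γ - 1))) := by
  -- The first term is the squared bias: `ε ≤ ε₀ n^{-β}`, the decay bound `A + 1` comes from taking
  -- `δ = 1`, and `t² = 2γ log n` contributes `(2γ)^{-α}`. The added `1` pays for the variance term.
  refine ⟨(ε₀ * (A + 1)) ^ 2 * (2 * γ) ^ (-α) + 1, by positivity, ?_⟩
  -- The frequency tends to infinity, so it eventually passes the threshold `T 1`, which is common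
  -- to the whole class.
  have hlim : Tendsto (fun n : ℕ => √(2 * γ * Real.log n)) atTop atTop :=
    Real.tendsto_sqrt_atTop.comp
      ((Real.tendsto_log_atTop.comp tendsto_natCast_atTop_atTop).const_mul_atTop (by positivity))
  filter_upwards [eventually_ge_atTop 2, hlim.eventually_ge_atTop (T 1)] with n hn hT
  have hn1 : (1 : ℝ) < n := by exact_mod_cast hn
  have hnpos : (0 : ℝ) < n := by linarith
  have hlog : 0 < Real.log n := Real.log_pos hn1
  set t := √(2 * γ * Real.log n) with ht
  have htpos : 0 < t := Real.sqrt_pos.2 (by positivity)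
  have ht2 : t ^ 2 = 2 * γ * Real.log n := Real.sq_sqrt (by positivity)
  have hexp : Real.exp (-(t ^ 2 / 2)) = (n : ℝ) ^ (-γ) := by
    rw [ht2, Real.rpow_def_of_pos hnpos]; congr 1; ring
  have hγγ : (n : ℝ) ^ γ * (n : ℝ) ^ (-γ) = 1 := by
    rw [← Real.rpow_add hnpos]; simp
  have hta : (t ^ (-α)) ^ 2 = (2 * γ) ^ (-α) * Real.log n ^ (-α) := by
    rw [← Real.mul_rpow (by positivity) hlog.le, ← ht2, ← Real.rpow_natCast, ← Real.rpow_natCast,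
      ← Real.rpow_mul htpos.le, ← Real.rpow_mul htpos.le]
    congr 1; push_cast; ring
  refine iSup₂_le fun p hp => ?_
  obtain ⟨h0, h1, ⟨H, h, hH, hdec, hfeq⟩, -⟩ := hp
  have hle1 : p.1 ≤ 1 := by
    have : (n : ℝ) ^ (-β) ≤ 1 := Real.rpow_le_one_of_one_le_of_nonpos hn1.le (by linarith)
    nlinarith
  have hmeas : Measurable (mixtureDensity p.1 H) := by
    have := hH.prob
    have h1 : StronglyMeasurable (fun x => ∫ p, component p x ∂H) :=
      StronglyMeasurable.integral_prod_right (f := fun (x : ℝ) (p : ℝ × ℝ) => component p x)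
        (measurable_component.comp (by fun_prop : Measurable fun z : ℝ × (ℝ × ℝ) => (z.2, z.1))
          ).stronglyMeasurable
    have h2 : mixtureDensity p.1 H =
      fun x => (1 - p.1) * stdPhi x + p.1 * ∫ p, component p x ∂H := rfl
    rw [h2]
    exact (measurable_stdPhi.const_mul _).add (h1.measurable.const_mul _)
  rw [hfeq]
  refine (mse_propEstimator_le (by omega) hmeas (hH.mixtureDensity_nonneg h0 hle1)
    (hH.lintegral_mixtureDensity h0 hle1)).trans (ENNReal.ofReal_le_ofReal ?_)
  have hB : ∀ σ, 1 ≤ σ → ‖condCharFun h σ t‖ ≤ (A + 1) * t ^ (-α) := by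
    intro σ hσ
    have := (hdec 1 one_pos t hT σ hσ).1
    rw [abs_of_pos htpos] at this
    rw [Real.rpow_neg htpos.le, ← div_eq_mul_inv, le_div_iff₀ (by positivity)]
    linarith
  have hbias := hH.abs_integral_cos_sub_le (ε := p.1) h0 hB
  rw [hexp] at hbias
  set m := ∫ x, mixtureDensity p.1 H x * Real.cos (t * x) with hm
  have hb : |1 - p.1 - (n : ℝ) ^ γ * m| ≤ ε₀ * (n : ℝ) ^ (-β) * ((A + 1) * t ^ (-α)) :=
    calc |1 - p.1 - (n : ℝ) ^ γ * m| = (n : ℝ) ^ γ * |m - (1 - p.1) * (n : ℝ) ^ (-γ)| := by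
          rw [← abs_of_pos (Real.rpow_pos_of_pos hnpos γ), ← abs_mul,
            abs_of_pos (Real.rpow_pos_of_pos hnpos γ), ← abs_neg]
          congr 1
          linear_combination (1 - p.1) * hγγ
      _ ≤ (n : ℝ) ^ γ * (p.1 * ((n : ℝ) ^ (-γ) * ((A + 1) * t ^ (-α)))) := by gcongr
      _ = p.1 * ((A + 1) * t ^ (-α)) := by
          linear_combination p.1 * ((A + 1) * t ^ (-α)) * hγγ
      _ ≤ _ := by gcongr
  have hb2 : (1 - p.1 - (n : ℝ) ^ γ * m) ^ 2 ≤
      (ε₀ * (A + 1)) ^ 2 * (2 * γ) ^ (-α) * rate α β n := by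
    rw [← sq_abs]
    calc |1 - p.1 - (n : ℝ) ^ γ * m| ^ 2 ≤ (ε₀ * (n : ℝ) ^ (-β) * ((A + 1) * t ^ (-α))) ^ 2 := by
          gcongr
      _ = (ε₀ * (A + 1)) ^ 2 * ((n : ℝ) ^ (-β)) ^ 2 * (t ^ (-α)) ^ 2 := by ring
      _ = _ := by
          rw [hta, rate, ← Real.rpow_natCast ((n : ℝ) ^ (-β)), ← Real.rpow_mul hnpos.le]
          have : -β * (2 : ℕ) = -2 * β := by push_cast; ring
          rw [this]; ring
  have hr : 0 ≤ rate α β n := by rw [rate]; positivity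
  have hn2 : 0 ≤ (n : ℝ) ^ (2 * γ - 1) := by positivity
  have hc : 0 ≤ (ε₀ * (A + 1)) ^ 2 * (2 * γ) ^ (-α) := by positivity
  nlinarith [mul_nonneg hc hn2]

/-! ### Lower bound: the two-point method -/

/-- Product measures are monotone in their factors. -/
theorem pi_le_pi {ι : Type*} [Fintype ι] {X : ι → Type*} [∀ i, MeasurableSpace (X i)]
    {μ ν : ∀ i, Measure (X i)} [∀ i, SigmaFinite (μ i)] [∀ i, SigmaFinite (ν i)]
    (h : ∀ i, μ i ≤ ν i) : Measure.pi μ ≤ Measure.pi ν := by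
  -- `OuterMeasure.pi` is the largest outer measure bounded on boxes by the product of the factors,
  -- so it is enough to compare the measures on boxes.
  have key : (Measure.pi μ).toOuterMeasure ≤ OuterMeasure.pi fun i => (ν i).toOuterMeasure := by
    rw [OuterMeasure.le_pi]
    intro s _
    calc Measure.pi μ (Set.univ.pi s) = ∏ i, μ i (s i) := Measure.pi_pi μ s
      _ ≤ ∏ i, ν i (s i) := Finset.prod_le_prod' fun i _ => h i (s i)
  refine Measure.le_iff.2 fun s hs => ?_
  have h2 : Measure.pi ν s = (OuterMeasure.pi fun i => (ν i).toOuterMeasure) s := by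
    rw [Measure.pi, toMeasure_apply _ _ hs]
  rw [h2]
  exact key s

/-- Total mass one is not assumed, because the lemma is applied to the minimum of two densities. -/
theorem sampleLaw_mono {n : ℕ} {f g : ℝ → ℝ} (hf : ∫⁻ x, ENNReal.ofReal (f x) ≠ ∞)
    (hg : ∫⁻ x, ENNReal.ofReal (g x) ≠ ∞) (h : ∀ x, f x ≤ g x) :
    sampleLaw n f ≤ sampleLaw n g := by
  have := isFiniteMeasure_withDensity hf
  have := isFiniteMeasure_withDensity hg
  exact pi_le_pi fun _ => withDensity_mono (ae_of_all _ fun x => ENNReal.ofReal_le_ofReal (h x))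

theorem sampleLaw_univ {n : ℕ} {f : ℝ → ℝ} (hf : ∫⁻ x, ENNReal.ofReal (f x) ≠ ∞) :
    sampleLaw n f Set.univ = (∫⁻ x, ENNReal.ofReal (f x)) ^ n := by
  have := isFiniteMeasure_withDensity hf
  rw [sampleLaw, Measure.pi_univ]
  simp

/-- Bernoulli's inequality for the affinity of two product laws. -/
theorem half_le_pow_of_one_sub_le {n : ℕ} (hn : 1 ≤ n) {ρ : ℝ≥0∞}
    (h : ENNReal.ofReal (1 - 1 / (2 * n)) ≤ ρ) : ENNReal.ofReal (1 / 2) ≤ ρ ^ n := by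
  have hn' : (1 : ℝ) ≤ n := by exact_mod_cast hn
  have h0 : (0 : ℝ) ≤ 1 - 1 / (2 * n) := by
    rw [sub_nonneg, div_le_one (by positivity)]; linarith
  calc ENNReal.ofReal (1 / 2) ≤ ENNReal.ofReal ((1 - 1 / (2 * n)) ^ n) := by
        apply ENNReal.ofReal_le_ofReal
        have := one_add_mul_le_pow (a := -(1 / (2 * (n : ℝ)))) (by linarith) n
        have h3 : (n : ℝ) * (1 / (2 * n)) = 1 / 2 := by field_simp
        calc (1 / 2 : ℝ) = 1 + n * -(1 / (2 * (n : ℝ))) := by linarith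
          _ ≤ _ := this
          _ = _ := by ring
    _ = ENNReal.ofReal (1 - 1 / (2 * n)) ^ n := ENNReal.ofReal_pow h0 n
    _ ≤ ρ ^ n := by gcongr

/-- Le Cam's two-point lower bound in terms of the affinity `∫ min(f₀, f₁)`. -/
theorem le_minimaxRisk_of_two_points {n : ℕ} (hn : 1 ≤ n) {S : Set (ℝ × (ℝ → ℝ))}
    {e₀ e₁ : ℝ} {f₀ f₁ : ℝ → ℝ} (h₀ : (e₀, f₀) ∈ S) (h₁ : (e₁, f₁) ∈ S)
    (hf₀ : ∫⁻ x, ENNReal.ofReal (f₀ x) ≠ ∞) (hf₁ : ∫⁻ x, ENNReal.ofReal (f₁ x) ≠ ∞)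
    (haff : ENNReal.ofReal (1 - 1 / (2 * n)) ≤ ∫⁻ x, ENNReal.ofReal (min (f₀ x) (f₁ x))) :
    ENNReal.ofReal ((e₁ - e₀) ^ 2 / 16) ≤ minimaxRisk n S := by
  refine le_iInf₂ fun est hest => ?_
  have hm : ∫⁻ x, ENNReal.ofReal (min (f₀ x) (f₁ x)) ≠ ∞ :=
    ne_top_of_le_ne_top hf₀ (lintegral_mono fun x => ENNReal.ofReal_le_ofReal (min_le_left _ _))
  set m : ℝ → ℝ := fun x => min (f₀ x) (f₁ x) with hmdef
  have hm₀ : sampleLaw n m ≤ sampleLaw n f₀ := sampleLaw_mono hm hf₀ fun x => min_le_left _ _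
  have hm₁ : sampleLaw n m ≤ sampleLaw n f₁ := sampleLaw_mono hm hf₁ fun x => min_le_right _ _
  -- Any estimate has summed squared errors at least half the squared gap, hence at least a quarter.
  -- Mass `1/2` common to both sample laws and the passage from the sum of two risks to their
  -- maximum give the remaining factor of four in `16`.
  set D : ℝ≥0∞ := ENNReal.ofReal ((e₁ - e₀) ^ 2 / 4) with hD
  have hpt : ∀ X, D ≤ ENNReal.ofReal ((est X - e₀) ^ 2) + ENNReal.ofReal ((est X - e₁) ^ 2) := by
    intro X
    rw [← ENNReal.ofReal_add (by positivity) (by positivity)]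
    apply ENNReal.ofReal_le_ofReal
    nlinarith [sq_nonneg (est X - e₀ + (est X - e₁)), sq_nonneg (e₁ - e₀)]
  have hmeas : Measurable fun X => ENNReal.ofReal ((est X - e₀) ^ 2) := by fun_prop
  have hsum : D * ENNReal.ofReal (1 / 2) ≤ mse est e₀ f₀ + mse est e₁ f₁ :=
    calc D * ENNReal.ofReal (1 / 2) ≤ D * sampleLaw n m Set.univ := by
          gcongr
          rw [sampleLaw_univ hm]
          exact half_le_pow_of_one_sub_le hn haff
      _ = ∫⁻ _, D ∂(sampleLaw n m) := by simp
      _ ≤ ∫⁻ X, (ENNReal.ofReal ((est X - e₀) ^ 2) + ENNReal.ofReal ((est X - e₁) ^ 2))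
            ∂(sampleLaw n m) := lintegral_mono hpt
      _ = ∫⁻ X, ENNReal.ofReal ((est X - e₀) ^ 2) ∂(sampleLaw n m) +
            ∫⁻ X, ENNReal.ofReal ((est X - e₁) ^ 2) ∂(sampleLaw n m) :=
          lintegral_add_left hmeas _
      _ ≤ mse est e₀ f₀ + mse est e₁ f₁ :=
          add_le_add (lintegral_mono' hm₀ le_rfl) (lintegral_mono' hm₁ le_rfl)
  have hr₀ : mse est e₀ f₀ ≤ maxRisk est S :=
    le_iSup₂ (f := fun (p : ℝ × (ℝ → ℝ)) (_ : p ∈ S) => mse est p.1 p.2) (e₀, f₀) h₀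
  have hr₁ : mse est e₁ f₁ ≤ maxRisk est S :=
    le_iSup₂ (f := fun (p : ℝ × (ℝ → ℝ)) (_ : p ∈ S) => mse est p.1 p.2) (e₁, f₁) h₁
  have h2 : 2 * ENNReal.ofReal ((e₁ - e₀) ^ 2 / 16) ≤ 2 * maxRisk est S := by
    calc 2 * ENNReal.ofReal ((e₁ - e₀) ^ 2 / 16)
        = D * ENNReal.ofReal (1 / 2) := by
          rw [hD, ← ENNReal.ofReal_mul (by positivity), ← ENNReal.ofReal_ofNat,
            ← ENNReal.ofReal_mul (by norm_num)]
          congr 1; ring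
      _ ≤ mse est e₀ f₀ + mse est e₁ f₁ := hsum
      _ ≤ 2 * maxRisk est S := by rw [two_mul]; exact add_le_add hr₀ hr₁
  exact (ENNReal.mul_le_mul_iff_right (by norm_num) (by norm_num)).1 h2

/-! ### A kernel with flat characteristic function -/

/-- The characteristic function `∫ e^{itu} h(u) du` of a function on the line. -/
def lineCharFun (h : ℝ → ℝ) (t : ℝ) : ℂ :=
  ∫ u : ℝ, Complex.exp (Complex.I * t * u) * (h u : ℂ)

open FourierTransform in
/-- A rapidly decreasing kernel whose characteristic function is a smooth cutoff. -/
theorem exists_flat_kernel :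
    ∃ κ χ : ℝ → ℝ, Continuous κ ∧ (∀ N : ℕ, ∃ D, 0 < D ∧ ∀ x, |κ x| * (1 + x ^ 2) ^ N ≤ D) ∧
      (∀ t, lineCharFun κ t = (χ t : ℂ)) ∧ ContDiff ℝ 1 χ ∧ HasCompactSupport χ ∧
      (∀ t, |t| ≤ 1 → χ t = 1) ∧ (∀ t, 0 ≤ χ t) ∧ ∀ t, χ t ≤ 1 := by
  -- The bump equals one on `[-1, 1]` and vanishes outside `[-2, 2]`; its inverse Fourier transform
  -- is a Schwartz function, whose real part is the kernel.
  let b : ContDiffBump (0 : ℝ) := ⟨1, 2, one_pos, one_lt_two⟩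
  have hbC : ContDiff ℝ (⊤ : ℕ∞) (fun x => (b x : ℂ)) :=
    Complex.ofRealCLM.contDiff.comp b.contDiff
  have hbS : HasCompactSupport (fun x => (b x : ℂ)) :=
    b.hasCompactSupport.comp_left (g := fun y : ℝ => (y : ℂ)) Complex.ofReal_zero
  let X : SchwartzMap ℝ ℂ := hbS.toSchwartzMap hbC
  have hX : ∀ x, X x = (b x : ℂ) := fun x => rfl
  let k : SchwartzMap ℝ ℂ := 𝓕⁻ X
  have hk : 𝓕 k = X := FourierTransform.fourier_fourierInv_eq X
  have hkx : ∀ x, k x = ∫ v : ℝ, Complex.exp (2 * Real.pi * v * x * Complex.I) * (b v : ℂ) := by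
    intro x
    have : k x = 𝓕⁻ (X : ℝ → ℂ) x := congrFun (SchwartzMap.fourierInv_coe X) x
    rw [this, Real.fourierInv_eq']
    congr 1; ext v
    rw [hX, smul_eq_mul]
    congr 2
    simp only [RCLike.inner_apply, conj_trivial]
    push_cast; ring
  -- The kernel is real because the bump is even.
  have hreal : ∀ x, ((k x).re : ℂ) = k x := by
    intro x
    rw [← Complex.conj_eq_iff_re, hkx, ← integral_conj]
    rw [← integral_neg_eq_self]
    congr 1; ext v
    rw [map_mul, Complex.conj_ofReal, b.neg, ← Complex.exp_conj]
    congr 2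
    simp only [map_mul, Complex.conj_ofReal, Complex.conj_I, map_ofNat]
    push_cast; ring
  refine ⟨fun x => (k x).re, fun t => b (t / (2 * Real.pi)), Complex.continuous_re.comp k.continuous,
    ?_, ?_, ?_, ?_, ?_, ?_, ?_⟩
  · intro N
    obtain ⟨C0, hC0, h0⟩ := k.decay 0 0
    obtain ⟨C1, hC1, h1⟩ := k.decay (2 * N) 0
    -- Convexity gives `(1 + x²)^N ≤ 2^{N-1} (1 + x^{2N})`, and the Schwartz seminorms of orders `0`
    -- and `2N` bound the two terms.
    refine ⟨2 ^ (N - 1) * (C0 + C1), by positivity, fun x => ?_⟩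
    have e0 := h0 x
    have e1 := h1 x
    simp only [norm_iteratedFDeriv_zero, pow_zero, one_mul] at e0 e1
    rw [pow_mul, Real.norm_eq_abs, sq_abs] at e1
    have hre : |(k x).re| ≤ ‖k x‖ := Complex.abs_re_le_norm _
    have hp := add_pow_le (zero_le_one' ℝ) (sq_nonneg x) N
    rw [one_pow] at hp
    calc |(k x).re| * (1 + x ^ 2) ^ N ≤ ‖k x‖ * (2 ^ (N - 1) * (1 + (x ^ 2) ^ N)) := by gcongr
      _ = 2 ^ (N - 1) * (‖k x‖ + (x ^ 2) ^ N * ‖k x‖) := by ring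
      _ ≤ _ := by gcongr
  · intro t
    -- The Fourier transform integrates against `e^{-2πixξ}` and `lineCharFun` against `e^{itu}`, so
    -- `ξ = -t/(2π)`; evenness of the bump removes the sign.
    have h1 : 𝓕 (k : ℝ → ℂ) (-(t / (2 * Real.pi))) = (b (t / (2 * Real.pi)) : ℂ) := by
      have : 𝓕 (k : ℝ → ℂ) = X := by rw [← SchwartzMap.fourier_coe, hk]
      rw [this, hX, b.neg]
    rw [← h1, Real.fourier_real_eq_integral_exp_smul, lineCharFun]
    congr 1; ext u
    rw [hreal, smul_eq_mul]
    congr 2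
    have := Real.pi_ne_zero
    push_cast; field_simp
  · exact b.contDiff.comp (contDiff_id.div_const _)
  · refine HasCompactSupport.comp_homeomorph (f := b) b.hasCompactSupport
      (Homeomorph.mulRight₀ (2 * Real.pi)⁻¹ (by positivity))
  · intro t ht
    refine b.one_of_mem_closedBall ?_
    rw [mem_closedBall_zero_iff, Real.norm_eq_abs, abs_div, abs_of_pos (by positivity : 0 < 2 * Real.pi)]
    change _ ≤ (1 : ℝ)
    rw [div_le_one (by positivity)]
    linarith [Real.pi_gt_three]
  · exact fun t => b.nonneg
  · exact fun t => b.le_one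

/-! ### Scale mixtures of centred normals -/

/-- The exponent at zero is `a - 1 > -1`, and at infinity it is `a - 1 + b < -1`. -/
theorem integrableOn_rpow_mul_one_add_rpow {a b : ℝ} (ha : 0 < a) (hab : a + b < 0) :
    IntegrableOn (fun v : ℝ => v ^ (a - 1) * (1 + v) ^ b) (Set.Ioi 0) := by
  have hm : Measurable fun v : ℝ => v ^ (a - 1) * (1 + v) ^ b := by fun_prop
  rw [← Set.Ioc_union_Ioi_eq_Ioi zero_le_one]
  refine IntegrableOn.union ?_ ?_
  · have h1 : IntegrableOn (fun v : ℝ => v ^ (a - 1)) (Set.Ioc 0 1) :=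
      (intervalIntegral.intervalIntegrable_rpow' (by linarith)).1
    refine h1.mono' hm.aestronglyMeasurable ?_
    filter_upwards [ae_restrict_mem measurableSet_Ioc] with v hv
    rw [Real.norm_of_nonneg (by have := hv.1; positivity)]
    have := hv.1
    exact mul_le_of_le_one_right (by positivity)
      (Real.rpow_le_one_of_one_le_of_nonpos (by linarith) (by linarith))
  · refine (integrableOn_Ioi_rpow_of_lt (a := a - 1 + b) (by linarith) one_pos).mono'
      hm.aestronglyMeasurable ?_
    filter_upwards [ae_restrict_mem measurableSet_Ioi] with v hv
    have hv0 : (0 : ℝ) < v := lt_trans one_pos hv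
    rw [Real.norm_of_nonneg (by positivity), Real.rpow_add hv0]
    exact mul_le_mul_of_nonneg_left
      (Real.rpow_le_rpow_of_nonpos hv0 (by linarith) (by linarith)) (by positivity)

/-- A probability weight on `(0, ∞)` of order `v^(α/2 - 1)` at `0`, with a small constant,
a polynomial lower bound and prescribed moments. -/
theorem exists_weight {α η q : ℝ} (hα : 0 < α) (hη : 0 < η) (hq : 0 ≤ q) :
    ∃ (w : ℝ → ℝ) (c P : ℝ), 0 < c ∧ 0 ≤ P ∧ Measurable w ∧ (∀ v, 0 < v → 0 ≤ w v) ∧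
      IntegrableOn (fun v => w v * (1 + v) ^ q) (Set.Ioi 0) ∧
      ∫ v in Set.Ioi 0, w v = 1 ∧ (∀ v, 0 < v → w v ≤ η * v ^ (α / 2 - 1)) ∧
      ∀ v, 0 < v → c * (v ^ (α / 2 - 1) * (1 + v) ^ (-P)) ≤ w v := by
  -- With this tail exponent, `g v * (1 + v) ^ q` decays like `v^{-2}` at infinity.
  set P : ℝ := α / 2 + q + 1 with hP
  have hP0 : 0 ≤ P := by positivity
  set g : ℝ → ℝ := fun v => v ^ (α / 2 - 1) * (1 + v) ^ (-P) with hg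
  have hgm : Measurable g := by rw [hg]; fun_prop
  have hgpos : ∀ v, 0 < v → 0 < g v := fun v hv => by simp only [hg]; positivity
  have hgi : IntegrableOn g (Set.Ioi 0) :=
    integrableOn_rpow_mul_one_add_rpow (by positivity) (by rw [hP]; linarith)
  have hgq : IntegrableOn (fun v => g v * (1 + v) ^ q) (Set.Ioi 0) := by
    refine (integrableOn_rpow_mul_one_add_rpow (a := α / 2) (b := -P + q) (by positivity)
      (by rw [hP]; linarith)).congr_fun (fun v hv => ?_) measurableSet_Ioi
    have hv0 : (0 : ℝ) < v := hv
    simp only [hg]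
    rw [Real.rpow_add (by positivity), mul_assoc]
  set Z := ∫ v in Set.Ioi 0, g v with hZ
  have hZpos : 0 < Z := by
    rw [hZ, setIntegral_pos_iff_support_of_nonneg_ae]
    · have : Function.support g ∩ Set.Ioi 0 = Set.Ioi 0 := by
        rw [Set.inter_eq_right]
        exact fun v hv => (hgpos v hv).ne'
      rw [this, Real.volume_Ioi]; exact ENNReal.zero_lt_top
    · filter_upwards [ae_restrict_mem measurableSet_Ioi] with v hv using (hgpos v hv).le
    · exact hgi
  -- Stretching the normalised `g` by `L` keeps its mass equal to one and multiplies its constant at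
  -- zero by `L^{-α/2}`, which can be made as small as desired.
  obtain ⟨L, hL1, hL⟩ : ∃ L : ℝ, 1 ≤ L ∧ L ^ (-(α / 2)) ≤ η * Z := by
    have := (tendsto_rpow_neg_atTop (by positivity : 0 < α / 2)).eventually
      (eventually_le_nhds (by positivity : 0 < η * Z))
    obtain ⟨L, h1, h2⟩ := ((eventually_ge_atTop (1 : ℝ)).and this).exists
    exact ⟨L, h1, h2⟩
  have hL0 : 0 < L := by linarith
  have hgL : ∀ v, 0 < v → L⁻¹ * g (L⁻¹ * v) =
      L ^ (-(α / 2)) * (v ^ (α / 2 - 1) * (1 + L⁻¹ * v) ^ (-P)) := by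
    intro v hv
    simp only [hg]
    rw [Real.mul_rpow (by positivity) hv.le, Real.inv_rpow hL0.le, ← Real.rpow_neg hL0.le]
    have : L⁻¹ = L ^ (-1 : ℝ) := by rw [Real.rpow_neg_one]
    nth_rw 1 [this]
    rw [← mul_assoc, ← mul_assoc, ← mul_assoc, ← Real.rpow_add hL0]
    congr 3; ring
  have hwpos : ∀ v, 0 < v → 0 ≤ Z⁻¹ * (L⁻¹ * g (L⁻¹ * v)) := by
    intro v hv
    have := hgpos (L⁻¹ * v) (by positivity)
    positivity
  have hbase : ∀ v, 0 < v → 1 ≤ 1 + L⁻¹ * v := by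
    intro v hv
    have : 0 < L⁻¹ * v := by positivity
    linarith
  refine ⟨fun v => Z⁻¹ * (L⁻¹ * g (L⁻¹ * v)), Z⁻¹ * L ^ (-(α / 2)), P, by positivity, hP0,
    by fun_prop, hwpos, ?_, ?_, ?_, ?_⟩
  · have h1 : IntegrableOn (fun v => g (L⁻¹ * v) * (1 + L⁻¹ * v) ^ q) (Set.Ioi 0) := by
      have := (integrableOn_Ioi_comp_mul_left_iff (fun v => g v * (1 + v) ^ q) 0
        (inv_pos.2 hL0)).2 (by simpa using hgq)
      exact this
    refine Integrable.mono' (h1.const_mul (Z⁻¹ * L⁻¹ * L ^ q)) (by fun_prop) ?_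
    filter_upwards [ae_restrict_mem measurableSet_Ioi] with v hv
    have hv0 : (0 : ℝ) < v := hv
    have hgv := hgpos (L⁻¹ * v) (by positivity)
    rw [Real.norm_of_nonneg (by have := hwpos v hv0; positivity)]
    have h2 : (1 + v) ^ q ≤ L ^ q * (1 + L⁻¹ * v) ^ q := by
      rw [← Real.mul_rpow hL0.le (by positivity)]
      refine Real.rpow_le_rpow (by positivity) ?_ hq
      rw [mul_add, mul_inv_cancel_left₀ hL0.ne']; linarith
    calc Z⁻¹ * (L⁻¹ * g (L⁻¹ * v)) * (1 + v) ^ q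
        ≤ Z⁻¹ * (L⁻¹ * g (L⁻¹ * v)) * (L ^ q * (1 + L⁻¹ * v) ^ q) := by
          have := hwpos v hv0
          gcongr
      _ = _ := by ring
  · rw [integral_const_mul, integral_const_mul, integral_comp_mul_left_Ioi g 0 (inv_pos.2 hL0)]
    simp only [mul_zero, inv_inv, smul_eq_mul]
    rw [← hZ]; field_simp
  · intro v hv
    simp only
    rw [hgL v hv]
    have h1 : (1 + L⁻¹ * v) ^ (-P) ≤ 1 :=
      Real.rpow_le_one_of_one_le_of_nonpos (hbase v hv) (by linarith)
    calc Z⁻¹ * (L ^ (-(α / 2)) * (v ^ (α / 2 - 1) * (1 + L⁻¹ * v) ^ (-P)))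
        ≤ Z⁻¹ * (η * Z * (v ^ (α / 2 - 1) * 1)) := by gcongr
      _ = _ := by field_simp
  · intro v hv
    simp only
    rw [hgL v hv, mul_assoc]
    gcongr ?_ * (?_ * (?_ * ?_))
    refine Real.rpow_le_rpow_of_nonpos (by have := hbase v hv; linarith) ?_ (by linarith)
    have : L⁻¹ * v ≤ v := mul_le_of_le_one_left hv.le (inv_le_one_of_one_le₀ hL1)
    linarith

/-- The centred normal density with variance `v`. -/
def centredPDF (v u : ℝ) : ℝ := gaussianPDFReal 0 v.toNNReal u

@[fun_prop]
theorem measurable_centredPDF : Measurable (Function.uncurry centredPDF) := by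
  have : Measurable fun z : ℝ × ℝ => ((0 : ℝ), z.1.toNNReal, z.2) := by fun_prop
  exact measurable_uncurry_gaussianPDFReal.comp this

theorem centredPDF_nonneg (v u : ℝ) : 0 ≤ centredPDF v u := gaussianPDFReal_nonneg _ _ _

theorem toNNReal_ne_zero_of_pos {v : ℝ} (hv : 0 < v) : v.toNNReal ≠ 0 := by simpa using hv

theorem integral_centredPDF {v : ℝ} (hv : 0 < v) : ∫ u, centredPDF v u = 1 :=
  integral_gaussianPDFReal_eq_one 0 (toNNReal_ne_zero_of_pos hv)

theorem integrable_centredPDF (v : ℝ) : Integrable (centredPDF v) :=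
  integrable_gaussianPDFReal 0 _

theorem centredPDF_eq {v : ℝ} (hv : 0 < v) (u : ℝ) :
    centredPDF v u = (√(2 * Real.pi * v))⁻¹ * Real.exp (-u ^ 2 / (2 * v)) := by
  rw [centredPDF, gaussianPDFReal, Real.coe_toNNReal _ hv.le, sub_zero]

theorem lineCharFun_centredPDF {v : ℝ} (hv : 0 < v) (t : ℝ) :
    lineCharFun (centredPDF v) t = (Real.exp (-(v * t ^ 2 / 2)) : ℂ) := by
  have := integral_exp_mul_gaussianPDFReal 0 t (toNNReal_ne_zero_of_pos hv)
  rw [Real.coe_toNNReal _ hv.le] at this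
  simpa [lineCharFun, centredPDF] using this

/-- The exponential compensates `v^{-1/2}` for small `v`. The bound is uniform in the variance,
which makes the scale mixture integral converge at every `u ≠ 0`, even though the densities at `u =
0` blow up as `v → 0`. -/
theorem centredPDF_le_inv_abs {v u : ℝ} (hv : 0 < v) (hu : u ≠ 0) : centredPDF v u ≤ |u|⁻¹ := by
  rw [centredPDF_eq hv, Real.sqrt_mul (by positivity), mul_inv]
  have hu' : 0 < |u| := abs_pos.2 hu
  have hs : 0 < √v := Real.sqrt_pos.2 hv
  have h1 : (√(2 * Real.pi))⁻¹ ≤ 1 := by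
    refine inv_le_one_of_one_le₀ (Real.one_le_sqrt.2 ?_)
    nlinarith [Real.pi_gt_three]
  have h2 : |u| / √v ≤ Real.exp (u ^ 2 / (2 * v)) := by
    have e : u ^ 2 / (2 * v) = (|u| / √v) ^ 2 / 2 := by
      rw [div_pow, sq_abs, Real.sq_sqrt hv.le]; field_simp
    rw [e]
    nlinarith [Real.add_one_le_exp ((|u| / √v) ^ 2 / 2), sq_nonneg (|u| / √v - 1)]
  have h3 : (√v)⁻¹ * Real.exp (-u ^ 2 / (2 * v)) ≤ |u|⁻¹ := by
    rw [neg_div, Real.exp_neg, ← mul_inv]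
    refine inv_anti₀ hu' ?_
    rwa [div_le_iff₀ hs, mul_comm] at h2
  calc (√(2 * Real.pi))⁻¹ * (√v)⁻¹ * Real.exp (-u ^ 2 / (2 * v))
      = (√(2 * Real.pi))⁻¹ * ((√v)⁻¹ * Real.exp (-u ^ 2 / (2 * v))) := by ring
    _ ≤ 1 * |u|⁻¹ := by gcongr
    _ = |u|⁻¹ := one_mul _

theorem lintegral_abs_rpow_centredPDF {v q : ℝ} (hv : 0 < v) :
    ∫⁻ u, ENNReal.ofReal (|u| ^ q * centredPDF v u) =
      ENNReal.ofReal (v ^ (q / 2)) * ∫⁻ z, ENNReal.ofReal (|z| ^ q) ∂(gaussianReal 0 1) := by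
  have h1 : ∫⁻ u, ENNReal.ofReal (|u| ^ q * centredPDF v u) =
      ∫⁻ u, ENNReal.ofReal (|u| ^ q) ∂(gaussianReal 0 v.toNNReal) := by
    rw [gaussianReal_of_var_ne_zero 0 (toNNReal_ne_zero_of_pos hv),
      lintegral_withDensity_eq_lintegral_mul _ (measurable_gaussianPDF _ _) (by fun_prop)]
    congr 1; ext u
    rw [Pi.mul_apply, mul_comm, ENNReal.ofReal_mul' (by positivity)]
    rw [mul_comm, gaussianPDF, centredPDF]
    rw [mul_comm]
  have h2 : gaussianReal 0 v.toNNReal = (gaussianReal 0 1).map (√v * ·) := by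
    rw [gaussianReal_map_const_mul]
    congr 1
    · simp
    · ext; simp [Real.sq_sqrt hv.le, Real.coe_toNNReal _ hv.le]
  rw [h1, h2, lintegral_map (by fun_prop) (by fun_prop), ← lintegral_const_mul _ (by fun_prop)]
  congr 1; ext z
  rw [← ENNReal.ofReal_mul (by positivity), abs_mul, abs_of_nonneg (Real.sqrt_nonneg v),
    Real.mul_rpow (by positivity) (by positivity), Real.sqrt_eq_rpow, ← Real.rpow_mul hv.le]
  congr 3; ring

theorem lintegral_abs_rpow_gaussianReal_lt_top (q : ℝ) (hq : 0 < q) :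
    ∫⁻ z, ENNReal.ofReal (|z| ^ q) ∂(gaussianReal 0 1) < ∞ := by
  have h := memLp_id_gaussianReal' (μ := 0) (v := 1) (ENNReal.ofReal q) ENNReal.ofReal_ne_top
  have h2 := h.integrable_norm_rpow (by simpa using hq) ENNReal.ofReal_ne_top
  rw [ENNReal.toReal_ofReal hq.le] at h2
  have := h2.lintegral_lt_top
  simpa [Real.norm_eq_abs] using this

/-- The scale mixture `∫ w(v) N(0, v) dv` of centred normal densities. -/
def scaleMixture (w : ℝ → ℝ) (u : ℝ) : ℝ := ∫ v in Set.Ioi 0, w v * centredPDF v u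

section

variable {w : ℝ → ℝ}

theorem measurable_scaleMixture (hwm : Measurable w) : Measurable (scaleMixture w) := by
  refine (StronglyMeasurable.integral_prod_right (f := fun (u v : ℝ) => w v * centredPDF v u)
    (Measurable.stronglyMeasurable ?_)).measurable
  have : Measurable fun z : ℝ × ℝ => centredPDF z.2 z.1 :=
    measurable_centredPDF.comp measurable_swap
  exact (hwm.comp measurable_snd).mul this

theorem scaleMixture_nonneg (hw0 : ∀ v, 0 < v → 0 ≤ w v) (u : ℝ) : 0 ≤ scaleMixture w u :=
  setIntegral_nonneg measurableSet_Ioi fun v hv => mul_nonneg (hw0 v hv) (centredPDF_nonneg v u)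

theorem integrable_prod_scaleMixture (hwm : Measurable w) (hw0 : ∀ v, 0 < v → 0 ≤ w v)
    (hwi : IntegrableOn w (Set.Ioi 0)) :
    Integrable (fun z : ℝ × ℝ => w z.2 * centredPDF z.2 z.1)
      (volume.prod (volume.restrict (Set.Ioi 0))) := by
  have hm : Measurable fun z : ℝ × ℝ => w z.2 * centredPDF z.2 z.1 :=
    (hwm.comp measurable_snd).mul (measurable_centredPDF.comp measurable_swap)
  rw [integrable_prod_iff' hm.aestronglyMeasurable]
  refine ⟨ae_of_all _ fun v => (integrable_centredPDF v).const_mul (w v), hwi.congr ?_⟩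
  filter_upwards [ae_restrict_mem measurableSet_Ioi] with v hv
  simp_rw [norm_mul, Real.norm_of_nonneg (hw0 v hv), Real.norm_of_nonneg (centredPDF_nonneg _ _)]
  rw [integral_const_mul, integral_centredPDF hv, mul_one]

theorem integrable_scaleMixture (hwm : Measurable w) (hw0 : ∀ v, 0 < v → 0 ≤ w v)
    (hwi : IntegrableOn w (Set.Ioi 0)) : Integrable (scaleMixture w) :=
  (integrable_prod_scaleMixture hwm hw0 hwi).integral_prod_left

theorem lineCharFun_scaleMixture (hwm : Measurable w) (hw0 : ∀ v, 0 < v → 0 ≤ w v)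
    (hwi : IntegrableOn w (Set.Ioi 0)) (t : ℝ) :
    lineCharFun (scaleMixture w) t =
      ((∫ v in Set.Ioi 0, w v * Real.exp (-(v * t ^ 2 / 2)) : ℝ) : ℂ) := by
  have hi : Integrable (fun z : ℝ × ℝ =>
      Complex.exp (Complex.I * t * z.1) * ((w z.2 * centredPDF z.2 z.1 : ℝ) : ℂ))
      (volume.prod (volume.restrict (Set.Ioi 0))) :=
    (integrable_prod_scaleMixture hwm hw0 hwi).ofReal.bdd_mul (c := 1)
      (by fun_prop) (ae_of_all _ fun z => (norm_exp_I_mul_mul t z.1).le)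
  calc lineCharFun (scaleMixture w) t
      = ∫ u : ℝ, ∫ v in Set.Ioi (0 : ℝ),
          Complex.exp (Complex.I * t * u) * ((w v * centredPDF v u : ℝ) : ℂ) := by
        rw [lineCharFun]
        congr 1; ext u
        rw [integral_const_mul, integral_complex_ofReal, scaleMixture]
    _ = ∫ v in Set.Ioi (0 : ℝ), ∫ u : ℝ,
          Complex.exp (Complex.I * t * u) * ((w v * centredPDF v u : ℝ) : ℂ) :=
        integral_integral_swap hi
    _ = ∫ v in Set.Ioi (0 : ℝ), ((w v * Real.exp (-(v * t ^ 2 / 2)) : ℝ) : ℂ) := by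
        refine setIntegral_congr_fun measurableSet_Ioi fun v hv => ?_
        rw [Complex.ofReal_mul, ← lineCharFun_centredPDF hv, lineCharFun, ← integral_const_mul]
        congr 1; ext u; push_cast; ring
    _ = _ := integral_complex_ofReal

theorem integral_scaleMixture (hwm : Measurable w) (hw0 : ∀ v, 0 < v → 0 ≤ w v)
    (hwi : IntegrableOn w (Set.Ioi 0)) :
    ∫ u, scaleMixture w u = ∫ v in Set.Ioi 0, w v := by
  have h := lineCharFun_scaleMixture hwm hw0 hwi 0
  simp only [lineCharFun, Complex.ofReal_zero, mul_zero, zero_mul, Complex.exp_zero, one_mul] at h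
  rw [integral_complex_ofReal] at h
  simpa using Complex.ofReal_injective h

/-- By Tonelli and scaling, the moment is at most that of `N(0,1)` times the integral of `w v * v ^
(q / 2)`, and `v ^ (q / 2) ≤ (1 + v) ^ q`. -/
theorem lintegral_abs_rpow_scaleMixture_lt_top {q : ℝ} (hq : 0 < q) (hwm : Measurable w)
    (hw0 : ∀ v, 0 < v → 0 ≤ w v)
    (hwq : IntegrableOn (fun v => w v * (1 + v) ^ q) (Set.Ioi 0)) :
    ∫⁻ u, ENNReal.ofReal (|u| ^ q * scaleMixture w u) < ∞ := by
  set M := ∫⁻ z, ENNReal.ofReal (|z| ^ q) ∂(gaussianReal 0 1) with hM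
  have hMt : M < ∞ := lintegral_abs_rpow_gaussianReal_lt_top q hq
  have hmeas : Measurable fun z : ℝ × ℝ =>
      ENNReal.ofReal (|z.1| ^ q) * ENNReal.ofReal (w z.2 * centredPDF z.2 z.1) :=
    Measurable.mul (by fun_prop)
      ((hwm.comp measurable_snd).mul (measurable_centredPDF.comp measurable_swap)).ennreal_ofReal
  calc ∫⁻ u, ENNReal.ofReal (|u| ^ q * scaleMixture w u)
      ≤ ∫⁻ u, ∫⁻ v in Set.Ioi (0 : ℝ),
          ENNReal.ofReal (|u| ^ q) * ENNReal.ofReal (w v * centredPDF v u) := by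
        refine lintegral_mono fun u => ?_
        simp only
        rw [ENNReal.ofReal_mul (by positivity), lintegral_const_mul _ (by
          exact ((hwm.mul (measurable_centredPDF.comp
            (by fun_prop : Measurable fun v : ℝ => (v, u)))).ennreal_ofReal))]
        gcongr
        refine (Real.ofReal_le_enorm _).trans ((enorm_integral_le_lintegral_enorm _).trans (le_of_eq ?_))
        refine setLIntegral_congr_fun measurableSet_Ioi fun v hv => ?_
        exact Real.enorm_of_nonneg (mul_nonneg (hw0 v hv) (centredPDF_nonneg v u))
    _ = ∫⁻ v in Set.Ioi (0 : ℝ), ∫⁻ u,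
          ENNReal.ofReal (|u| ^ q) * ENNReal.ofReal (w v * centredPDF v u) :=
        lintegral_lintegral_swap hmeas.aemeasurable
    _ ≤ ∫⁻ v in Set.Ioi (0 : ℝ), ENNReal.ofReal (w v * (1 + v) ^ q) * M := by
        refine setLIntegral_mono' measurableSet_Ioi fun v hv => ?_
        have hv0 : (0 : ℝ) < v := hv
        have hwv := hw0 v hv0
        have e : ∀ u, ENNReal.ofReal (|u| ^ q) * ENNReal.ofReal (w v * centredPDF v u) =
            ENNReal.ofReal (w v) * ENNReal.ofReal (|u| ^ q * centredPDF v u) := by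
          intro u
          rw [ENNReal.ofReal_mul hwv, ENNReal.ofReal_mul (by positivity)]; ring
        simp_rw [e]
        rw [lintegral_const_mul' _ _ ENNReal.ofReal_ne_top,
          lintegral_abs_rpow_centredPDF hv0, ← mul_assoc, ← ENNReal.ofReal_mul hwv]
        gcongr
        calc v ^ (q / 2) ≤ (1 + v) ^ (q / 2) := by gcongr; linarith
          _ ≤ (1 + v) ^ q := Real.rpow_le_rpow_of_exponent_le (by linarith) (by linarith)
    _ = (∫⁻ v in Set.Ioi (0 : ℝ), ENNReal.ofReal (w v * (1 + v) ^ q)) * M :=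
        lintegral_mul_const' _ _ hMt.ne
    _ < ∞ := ENNReal.mul_lt_top hwq.lintegral_lt_top hMt

/-- Lower bound for a scale mixture from the weight of variances of order `r ≥ u²`. -/
theorem exists_le_scaleMixture {α c P : ℝ} (hc : 0 < c) (hP : 0 ≤ P) (hwm : Measurable w)
    (hw0 : ∀ v, 0 < v → 0 ≤ w v) (hwi : IntegrableOn w (Set.Ioi 0))
    (hlow : ∀ v, 0 < v → c * (v ^ (α / 2 - 1) * (1 + v) ^ (-P)) ≤ w v) :
    ∃ c' : ℝ, 0 < c' ∧ ∀ u r : ℝ, u ≠ 0 → u ^ 2 ≤ r →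
      c' * (r ^ ((α - 1) / 2) * (1 + r) ^ (-P)) ≤ scaleMixture w u := by
  set a := α / 2 - 1 with ha
  -- On `[r/2, r]` the power `v ^ a` is at least `m * r ^ a` whatever the sign of `a`.
  set m : ℝ := min 1 ((1 / 2) ^ a) with hm
  have hmpos : 0 < m := by rw [hm]; positivity
  refine ⟨1 / 2 * (c * m * ((√(2 * Real.pi))⁻¹ * Real.exp (-1))), by positivity, ?_⟩
  intro u r hu hur
  have hr : 0 < r := lt_of_lt_of_le (by positivity) hur
  -- Only variances in `[r/2, r]` are kept. There `u² ≤ r` gives `u²/(2v) ≤ 1`, so the exponential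
  -- is at least `e^{-1}`; the window length `r/2` times `r^a r^{-1/2}` produces `r^{(α-1)/2}`.
  set B := c * (m * r ^ a * (1 + r) ^ (-P)) * ((√(2 * Real.pi * r))⁻¹ * Real.exp (-1)) with hB
  have hint : IntegrableOn (fun v => w v * centredPDF v u) (Set.Ioi 0) := by
    refine Integrable.mono' (hwi.mul_const |u|⁻¹) ?_ ?_
    · exact (hwm.mul (measurable_centredPDF.comp
        (by fun_prop : Measurable fun v : ℝ => (v, u)))).aestronglyMeasurable
    · filter_upwards [ae_restrict_mem measurableSet_Ioi] with v hv
      rw [Real.norm_of_nonneg (mul_nonneg (hw0 v hv) (centredPDF_nonneg v u))]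
      exact mul_le_mul_of_nonneg_left (centredPDF_le_inv_abs hv hu) (hw0 v hv)
  have hsub : Set.Icc (r / 2) r ⊆ Set.Ioi 0 := fun v hv => lt_of_lt_of_le (by positivity) hv.1
  have hpt : ∀ v ∈ Set.Icc (r / 2) r, B ≤ w v * centredPDF v u := by
    intro v hv
    have hv0 : 0 < v := hsub hv
    have h1 : m * r ^ a ≤ v ^ a := by
      rcases le_or_gt 0 a with ha0 | ha0
      · calc m * r ^ a ≤ (1 / 2) ^ a * r ^ a := by gcongr; exact min_le_right _ _
          _ = (r / 2) ^ a := by rw [← Real.mul_rpow (by norm_num) hr.le]; congr 1; ring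
          _ ≤ v ^ a := Real.rpow_le_rpow (by positivity) hv.1 ha0
      · calc m * r ^ a ≤ 1 * r ^ a := by gcongr; exact min_le_left _ _
          _ = r ^ a := one_mul _
          _ ≤ v ^ a := Real.rpow_le_rpow_of_nonpos hv0 hv.2 ha0.le
    have h2 : (1 + r) ^ (-P) ≤ (1 + v) ^ (-P) :=
      Real.rpow_le_rpow_of_nonpos (by positivity) (by linarith [hv.2]) (by linarith)
    have h3 : (√(2 * Real.pi * r))⁻¹ * Real.exp (-1) ≤ centredPDF v u := by
      rw [centredPDF_eq hv0]
      refine mul_le_mul ?_ ?_ (by positivity) (by positivity)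
      · refine inv_anti₀ (by positivity) (Real.sqrt_le_sqrt ?_)
        have := hv.2; gcongr
      · rw [Real.exp_le_exp, neg_div, neg_le_neg_iff, div_le_one (by positivity)]
        linarith [hv.1]
    refine mul_le_mul (le_trans ?_ (hlow v hv0)) h3 (by positivity) (hw0 v hv0)
    gcongr
  have hB2 : 1 / 2 * (c * m * ((√(2 * Real.pi))⁻¹ * Real.exp (-1))) *
      (r ^ ((α - 1) / 2) * (1 + r) ^ (-P)) = (r - r / 2) * B := by
    have e : r ^ ((α - 1) / 2) = r * (r ^ a * (√r)⁻¹) := by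
      rw [Real.sqrt_eq_rpow, ← Real.rpow_neg hr.le, ← Real.rpow_add hr]
      nth_rw 2 [← Real.rpow_one r]
      rw [← Real.rpow_add hr]; congr 1; rw [ha]; ring
    rw [hB, e, Real.sqrt_mul (by positivity) r, mul_inv]
    ring
  rw [hB2]
  calc (r - r / 2) * B = ∫ _ in Set.Icc (r / 2) r, B := by
        rw [setIntegral_const, smul_eq_mul, Real.volume_real_Icc_of_le (by linarith)]
    _ ≤ ∫ v in Set.Icc (r / 2) r, w v * centredPDF v u :=
        setIntegral_mono_on (by simp) (hint.mono_set hsub) measurableSet_Icc hpt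
    _ ≤ scaleMixture w u := by
        refine setIntegral_mono_set hint ?_ hsub.eventuallyLE
        filter_upwards [ae_restrict_mem measurableSet_Ioi] with v hv
        exact mul_nonneg (hw0 v hv) (centredPDF_nonneg v u)

end

/-! ### Decay of the characteristic function of a scale mixture -/

theorem abs_rpow_mul_one_div_rpow {t b : ℝ} (ht : t ≠ 0) :
    |t| ^ (2 * b) * (1 / (t ^ 2 / 2)) ^ b = 2 ^ b := by
  have h0 : 0 < |t| := abs_pos.2 ht
  have h1 : 1 / (t ^ 2 / 2) = 2 / |t| ^ 2 := by rw [sq_abs]; field_simp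
  rw [h1, Real.div_rpow (by norm_num) (by positivity), Real.rpow_mul h0.le, Real.rpow_two]
  field_simp

theorem integrableOn_rpow_mul_exp_neg_mul {a r : ℝ} (ha : 0 < a) (hr : 0 < r) :
    IntegrableOn (fun v : ℝ => v ^ (a - 1) * Real.exp (-(r * v))) (Set.Ioi 0) := by
  refine Integrable.of_integral_ne_zero ?_
  rw [Real.integral_rpow_mul_exp_neg_mul_Ioi ha hr]
  have := Real.Gamma_pos_of_pos ha
  positivity

section

variable {w : ℝ → ℝ} {α η : ℝ}

/-- Comparison with the Gamma integral of `v^{b-1} e^{-v t²/2}`, which equals `Γ(b) (2/t²)^b`. It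
serves with `b = α/2` for the characteristic function and with `b = α/2 + 1` for its derivative. -/
theorem abs_rpow_mul_integral_le {t b : ℝ} (hb : 0 < b) (ht : t ≠ 0)
    (hw0 : ∀ v, 0 < v → 0 ≤ w v) (hη : ∀ v, 0 < v → w v ≤ η * v ^ (b - 1)) :
    |t| ^ (2 * b) * ∫ v in Set.Ioi 0, w v * Real.exp (-(v * t ^ 2 / 2)) ≤
      η * (2 ^ b * Real.Gamma b) := by
  have hr : 0 < t ^ 2 / 2 := by positivity
  have h1 : ∫ v in Set.Ioi 0, w v * Real.exp (-(v * t ^ 2 / 2)) ≤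
      ∫ v in Set.Ioi 0, η * (v ^ (b - 1) * Real.exp (-(t ^ 2 / 2 * v))) := by
    refine integral_mono_of_nonneg ?_ ((integrableOn_rpow_mul_exp_neg_mul hb hr).const_mul η) ?_
    · filter_upwards [ae_restrict_mem measurableSet_Ioi] with v hv
      exact mul_nonneg (hw0 v hv) (Real.exp_nonneg _)
    · filter_upwards [ae_restrict_mem measurableSet_Ioi] with v hv
      have e : v * t ^ 2 / 2 = t ^ 2 / 2 * v := by ring
      rw [e, ← mul_assoc]
      exact mul_le_mul_of_nonneg_right (hη v hv) (Real.exp_nonneg _)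
  rw [integral_const_mul, Real.integral_rpow_mul_exp_neg_mul_Ioi hb hr] at h1
  calc |t| ^ (2 * b) * ∫ v in Set.Ioi 0, w v * Real.exp (-(v * t ^ 2 / 2))
      ≤ |t| ^ (2 * b) * (η * ((1 / (t ^ 2 / 2)) ^ b * Real.Gamma b)) := by gcongr
    _ = η * (|t| ^ (2 * b) * (1 / (t ^ 2 / 2)) ^ b * Real.Gamma b) := by ring
    _ = _ := by rw [abs_rpow_mul_one_div_rpow ht]

/-- Differentiation under the integral; on the unit ball around `t` the derivative is dominated by
`(|t| + 1) w(v) v`. -/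
theorem hasDerivAt_integral_weight (hwm : Measurable w) (hw0 : ∀ v, 0 < v → 0 ≤ w v)
    (hwi : IntegrableOn w (Set.Ioi 0)) (hwv : IntegrableOn (fun v => w v * v) (Set.Ioi 0))
    (t : ℝ) :
    HasDerivAt (fun t : ℝ => ∫ v in Set.Ioi 0, w v * Real.exp (-(v * t ^ 2 / 2)))
      (∫ v in Set.Ioi 0, w v * (Real.exp (-(v * t ^ 2 / 2)) * (-(v * t)))) t := by
  have hexp : ∀ v s : ℝ, 0 < v → Real.exp (-(v * s ^ 2 / 2)) ≤ 1 := by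
    intro v s hv
    rw [Real.exp_le_one_iff]
    have : 0 ≤ v * s ^ 2 / 2 := by positivity
    linarith
  refine (hasDerivAt_integral_of_dominated_loc_of_deriv_le (𝕜 := ℝ) (s := Metric.ball t 1)
    (F := fun t v : ℝ => w v * Real.exp (-(v * t ^ 2 / 2)))
    (F' := fun t v : ℝ => w v * (Real.exp (-(v * t ^ 2 / 2)) * (-(v * t))))
    (bound := fun v => (|t| + 1) * (w v * v)) (Metric.ball_mem_nhds t one_pos) ?_ ?_ ?_ ?_ ?_ ?_).2
  · exact Eventually.of_forall fun s => by fun_prop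
  · refine hwi.mono' (by fun_prop) ?_
    filter_upwards [ae_restrict_mem measurableSet_Ioi] with v hv
    rw [Real.norm_of_nonneg (mul_nonneg (hw0 v hv) (Real.exp_nonneg _))]
    exact mul_le_of_le_one_right (hw0 v hv) (hexp v t hv)
  · fun_prop
  · filter_upwards [ae_restrict_mem measurableSet_Ioi] with v hv s hs
    have hv0 : (0 : ℝ) < v := hv
    have hs1 : |s| ≤ |t| + 1 := by
      have h1 : |s - t| < 1 := hs
      have h2 := abs_sub_abs_le_abs_sub s t
      linarith
    rw [norm_mul, norm_mul, Real.norm_of_nonneg (hw0 v hv), Real.norm_of_nonneg (Real.exp_nonneg _),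
      norm_neg, norm_mul, Real.norm_of_nonneg hv0.le, Real.norm_eq_abs]
    have := hw0 v hv
    calc w v * (Real.exp (-(v * s ^ 2 / 2)) * (v * |s|)) ≤ w v * (1 * (v * (|t| + 1))) := by
          gcongr; exact hexp v s hv0
      _ = _ := by ring
  · exact hwv.const_mul _
  · filter_upwards [] with v s hs
    have h1 : HasDerivAt (fun s : ℝ => -(v * s ^ 2 / 2)) (-(v * s)) s := by
      have := (((hasDerivAt_pow 2 s).const_mul v).div_const 2).neg
      convert! this using 1
      simp; ring
    exact h1.exp.const_mul _

end

/-- Densities whose characteristic function decays at rate `|t|^(-α)`, with an arbitrarily small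
constant, and which dominate `r^((α - 1)/2) (1 + r)^(-P)` for `r ≥ u²`. -/
theorem exists_base_density {α η q : ℝ} (hα : 0 < α) (hη : 0 < η) (hq : 1 ≤ q) :
    ∃ (h : ℝ → ℝ) (c P : ℝ), 0 < c ∧ 0 ≤ P ∧ Measurable h ∧ (∀ u, 0 ≤ h u) ∧ Integrable h ∧
      ∫ u, h u = 1 ∧ ∫⁻ u, ENNReal.ofReal (|u| ^ q * h u) < ∞ ∧
      (∀ t, |t| ^ α * ‖lineCharFun h t‖ ≤ η ∧ DifferentiableAt ℝ (lineCharFun h) t ∧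
        |t| ^ (α + 1) * ‖deriv (lineCharFun h) t‖ ≤ η) ∧
      ∀ u r : ℝ, u ≠ 0 → u ^ 2 ≤ r → c * (r ^ ((α - 1) / 2) * (1 + r) ^ (-P)) ≤ h u := by
  have hG1 := Real.Gamma_pos_of_pos (by positivity : 0 < α / 2)
  have hG2 := Real.Gamma_pos_of_pos (by positivity : 0 < α / 2 + 1)
  set K1 : ℝ := 2 ^ (α / 2) * Real.Gamma (α / 2) with hK1
  set K2 : ℝ := 2 ^ (α / 2 + 1) * Real.Gamma (α / 2 + 1) with hK2
  have hK1p : 0 < K1 := by positivity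
  have hK2p : 0 < K2 := by positivity
  -- `K1` and `K2` are the Gamma constants of the characteristic function and of its derivative;
  -- this choice keeps both bounds below `η`.
  set η' := η / (K1 + K2) with hη'
  have hη'p : 0 < η' := by positivity
  have hηK : η' * K1 ≤ η ∧ η' * K2 ≤ η := by
    have e : η' * (K1 + K2) = η := by rw [hη']; field_simp
    constructor <;> nlinarith [mul_pos hη'p hK1p, mul_pos hη'p hK2p]
  obtain ⟨w, c, P, hc, hP, hwm, hw0, hwq, hw1, hwη, hlow⟩ :=
    exists_weight (α := α) (η := η') (q := q) hα hη'p (by linarith)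
  have hge : ∀ v : ℝ, 0 < v → 1 + v ≤ (1 + v) ^ q := fun v hv => by
    simpa using Real.rpow_le_rpow_of_exponent_le (by linarith : 1 ≤ 1 + v) hq
  have hwi : IntegrableOn w (Set.Ioi 0) := by
    refine hwq.mono' hwm.aestronglyMeasurable ?_
    filter_upwards [ae_restrict_mem measurableSet_Ioi] with v hv
    have hv0 : (0 : ℝ) < v := hv
    rw [Real.norm_of_nonneg (hw0 v hv)]
    exact le_mul_of_one_le_right (hw0 v hv) (by linarith [hge v hv])
  have hwv : IntegrableOn (fun v => w v * v) (Set.Ioi 0) := by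
    refine hwq.mono' (by fun_prop) ?_
    filter_upwards [ae_restrict_mem measurableSet_Ioi] with v hv
    have hv0 : (0 : ℝ) < v := hv
    rw [Real.norm_of_nonneg (mul_nonneg (hw0 v hv) hv0.le)]
    exact mul_le_mul_of_nonneg_left (by linarith [hge v hv]) (hw0 v hv)
  obtain ⟨c', hc', hlow'⟩ := exists_le_scaleMixture (α := α) hc hP hwm hw0 hwi hlow
  have hcf : lineCharFun (scaleMixture w) = fun t : ℝ =>
      ((∫ v in Set.Ioi 0, w v * Real.exp (-(v * t ^ 2 / 2)) : ℝ) : ℂ) :=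
    funext fun t => lineCharFun_scaleMixture hwm hw0 hwi t
  have hd : ∀ t, HasDerivAt (lineCharFun (scaleMixture w))
      ((∫ v in Set.Ioi 0, w v * (Real.exp (-(v * t ^ 2 / 2)) * (-(v * t))) : ℝ) : ℂ) t := by
    intro t
    rw [hcf]
    exact (hasDerivAt_integral_weight hwm hw0 hwi hwv t).ofReal_comp
  refine ⟨scaleMixture w, c', P, hc', hP, measurable_scaleMixture hwm, scaleMixture_nonneg hw0,
    integrable_scaleMixture hwm hw0 hwi, (integral_scaleMixture hwm hw0 hwi).trans hw1,
    lintegral_abs_rpow_scaleMixture_lt_top (by linarith) hwm hw0 hwq, fun t => ⟨?_, ?_, ?_⟩, hlow'⟩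
  · rcases eq_or_ne t 0 with rfl | ht
    · rw [abs_zero, Real.zero_rpow hα.ne', zero_mul]; exact hη.le
    rw [hcf]
    simp only
    rw [Complex.norm_real, Real.norm_of_nonneg (setIntegral_nonneg measurableSet_Ioi fun v hv =>
      mul_nonneg (hw0 v hv) (Real.exp_nonneg _))]
    have := abs_rpow_mul_integral_le (b := α / 2) (by positivity) ht hw0 hwη
    rw [mul_div_cancel₀ α two_ne_zero] at this
    exact this.trans hηK.1
  · exact (hd t).differentiableAt
  · rcases eq_or_ne t 0 with rfl | ht
    · rw [abs_zero, Real.zero_rpow (by linarith), zero_mul]; exact hη.le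
    rw [(hd t).deriv, Complex.norm_real]
    -- The derivative is `-t` times a transform of the same type with weight `w v * v`, of order
    -- `v^{α/2}` at zero. The gain `|t|^{-2}` against the factor `t` leaves one extra power of
    -- decay.
    have e : ∫ v in Set.Ioi 0, w v * (Real.exp (-(v * t ^ 2 / 2)) * (-(v * t))) =
        -t * ∫ v in Set.Ioi 0, (w v * v) * Real.exp (-(v * t ^ 2 / 2)) := by
      rw [← integral_const_mul]; congr 1; ext v; ring
    have hw0' : ∀ v, 0 < v → 0 ≤ w v * v := fun v hv => mul_nonneg (hw0 v hv) hv.le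
    rw [e, norm_mul, norm_neg, Real.norm_eq_abs, Real.norm_of_nonneg
      (setIntegral_nonneg measurableSet_Ioi fun v hv =>
        mul_nonneg (hw0' v hv) (Real.exp_nonneg _))]
    have := abs_rpow_mul_integral_le (w := fun v => w v * v) (η := η') (b := α / 2 + 1)
      (by positivity) ht hw0' (fun v hv => by
        have := mul_le_mul_of_nonneg_right (hwη v hv) hv.le
        refine this.trans (le_of_eq ?_)
        rw [mul_assoc, ← Real.rpow_add_one hv.ne']; congr 2; ring)
    have e2 : |t| ^ (2 * (α / 2 + 1)) = |t| ^ (α + 1) * |t| := by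
      rw [← Real.rpow_add_one (abs_pos.2 ht).ne']; congr 1; ring
    rw [e2, mul_assoc] at this
    exact this.trans hηK.2

/-! ### Gaussian smoothing and the perturbation -/

/-- A probability density whose characteristic function satisfies
`|t|^α |ĥ(t)| ≤ A` and `|t|^(α+1) |ĥ'(t)| ≤ A` for all `t`. -/
structure IsDecayDensity (α A : ℝ) (h : ℝ → ℝ) : Prop where
  measurable : Measurable h
  nonneg : ∀ u, 0 ≤ h u
  integrable : Integrable h
  integral_eq : ∫ u, h u = 1
  decay : ∀ t, |t| ^ α * ‖lineCharFun h t‖ ≤ A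
  differentiable : ∀ t, DifferentiableAt ℝ (lineCharFun h) t
  decay_deriv : ∀ t, |t| ^ (α + 1) * ‖deriv (lineCharFun h) t‖ ≤ A

/-- The convolution of a function with the standard normal density. -/
def gaussSmooth (h : ℝ → ℝ) (x : ℝ) : ℝ := ∫ u, h u * stdPhi (x - u)

theorem integrable_mul_stdPhi {h : ℝ → ℝ} (hi : Integrable h) (x : ℝ) :
    Integrable fun u => h u * stdPhi (x - u) := by
  refine hi.mul_bdd (c := 1)
    (measurable_stdPhi.comp (measurable_const.sub measurable_id)).aestronglyMeasurable
    (ae_of_all _ fun u => ?_)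
  rw [Real.norm_of_nonneg (stdPhi_nonneg _)]
  exact stdPhi_le_one _

theorem integrable_exp_mul {h : ℝ → ℝ} (hi : Integrable h) (t : ℝ) :
    Integrable fun u : ℝ => Complex.exp (Complex.I * t * u) * (h u : ℂ) :=
  hi.ofReal.bdd_mul (c := 1) (by fun_prop) (ae_of_all _ fun u => (norm_exp_I_mul_mul t u).le)

/-- The normal density as an average of exponentials over the normal law. -/
theorem stdPhi_eq_integral (y : ℝ) :
    (stdPhi y : ℂ) = (√(2 * Real.pi))⁻¹ *
      ∫ t : ℝ, Complex.exp (Complex.I * y * t) * (stdPhi t : ℂ) := by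
  rw [integral_exp_mul_stdPhi, stdPhi_eq, neg_div]
  push_cast; ring

/-- Smoothing an integrable kernel, on the Fourier side. -/
theorem gaussSmooth_eq_integral {k : ℝ → ℝ} (hi : Integrable k) (x : ℝ) :
    (gaussSmooth k x : ℂ) = (√(2 * Real.pi))⁻¹ *
      ∫ t : ℝ, Complex.exp (Complex.I * x * t) * (stdPhi t : ℂ) * lineCharFun k (-t) := by
  -- `φ(x - u)` is written as a Fourier integral; exchanging the integrals leaves the factor
  -- `e^{-itu}` against `k`, hence the argument `-t`.
  have hprod : Integrable (fun z : ℝ × ℝ =>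
      Complex.exp (Complex.I * ((x - z.1 : ℝ) : ℂ) * z.2) * ((k z.1 : ℂ) * (stdPhi z.2 : ℂ)))
      (volume.prod volume) := by
    refine (hi.ofReal.mul_prod integrable_stdPhi.ofReal).bdd_mul (c := 1) (by fun_prop)
      (ae_of_all _ fun z => (norm_exp_I_mul_mul (x - z.1) z.2).le)
  calc (gaussSmooth k x : ℂ) = ∫ u : ℝ, (k u : ℂ) * (stdPhi (x - u) : ℂ) := by
        rw [gaussSmooth, ← integral_complex_ofReal]; push_cast; rfl
    _ = ∫ u : ℝ, (((√(2 * Real.pi))⁻¹ : ℝ) : ℂ) * ∫ t : ℝ,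
          Complex.exp (Complex.I * ((x - u : ℝ) : ℂ) * t) * ((k u : ℂ) * (stdPhi t : ℂ)) := by
        congr 1; ext u
        rw [stdPhi_eq_integral, mul_left_comm, ← integral_const_mul (k u : ℂ)]
        congr 2; ext t; ring
    _ = (((√(2 * Real.pi))⁻¹ : ℝ) : ℂ) * ∫ t : ℝ, ∫ u : ℝ,
          Complex.exp (Complex.I * ((x - u : ℝ) : ℂ) * t) * ((k u : ℂ) * (stdPhi t : ℂ)) := by
        rw [integral_const_mul, integral_integral_swap hprod]
    _ = _ := by
        congr 2; ext t
        rw [lineCharFun, ← integral_const_mul]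
        congr 1; ext u
        have : Complex.exp (Complex.I * ((x - u : ℝ) : ℂ) * t) =
            Complex.exp (Complex.I * x * t) * Complex.exp (Complex.I * ((-t : ℝ) : ℂ) * u) := by
          rw [← Complex.exp_add]; congr 1; push_cast; ring
        rw [this]; ring

/-- Gaussian smoothing hardly distinguishes a point mass from a kernel whose characteristic
function equals one on `[-τ, τ]`. -/
theorem abs_gaussSmooth_sub_stdPhi_le {k χ : ℝ → ℝ} {τ : ℝ} (hi : Integrable k)
    (hχm : Measurable χ) (hcf : ∀ t, lineCharFun k t = (χ t : ℂ)) (hτ : 0 ≤ τ)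
    (h1 : ∀ t, |t| ≤ τ → χ t = 1) (h0 : ∀ t, 0 ≤ χ t) (hle : ∀ t, χ t ≤ 1) (x : ℝ) :
    |gaussSmooth k x - stdPhi x| ≤
      Real.exp (-(τ ^ 2 / 4)) * ∫ t : ℝ, Real.exp (-(1 / 4) * t ^ 2) := by
  have hs : (√(2 * Real.pi))⁻¹ ≤ 1 := by
    refine inv_le_one_of_one_le₀ (Real.one_le_sqrt.2 ?_)
    nlinarith [Real.pi_gt_three]
  have hφi := integrable_exp_mul integrable_stdPhi x
  have hχi : Integrable fun t : ℝ =>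
      Complex.exp (Complex.I * x * t) * (stdPhi t : ℂ) * lineCharFun k (-t) := by
    simp_rw [hcf]
    refine hφi.mul_bdd (c := 1)
      (hχm.comp measurable_neg).complex_ofReal.aestronglyMeasurable (ae_of_all _ fun t => ?_)
    rw [Complex.norm_real, Real.norm_of_nonneg (h0 _)]; exact hle _
  have hnorm : |gaussSmooth k x - stdPhi x| =
      ‖(((√(2 * Real.pi))⁻¹ : ℝ) : ℂ) * ∫ t : ℝ,
        (Complex.exp (Complex.I * x * t) * (stdPhi t : ℂ)) * ((χ (-t) - 1 : ℝ) : ℂ)‖ := by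
    rw [← Real.norm_eq_abs, ← Complex.norm_real, Complex.ofReal_sub, gaussSmooth_eq_integral hi,
      stdPhi_eq_integral, ← mul_sub, ← integral_sub hχi hφi]
    congr 3; ext t
    rw [hcf]; push_cast; ring
  have hg : Integrable fun t : ℝ => Real.exp (-(τ ^ 2 / 4)) * Real.exp (-(1 / 4) * t ^ 2) :=
    (integrable_exp_neg_mul_sq (by norm_num)).const_mul _
  have hI := norm_integral_le_of_norm_le (μ := volume) (f := fun t : ℝ =>
    (Complex.exp (Complex.I * x * t) * (stdPhi t : ℂ)) * ((χ (-t) - 1 : ℝ) : ℂ)) hg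
    (ae_of_all _ fun t => by
      rw [norm_mul, norm_mul, norm_exp_I_mul_mul, one_mul, Complex.norm_real, Complex.norm_real,
        Real.norm_of_nonneg (stdPhi_nonneg t)]
      -- Frequencies up to `τ` contribute nothing. Beyond them `t²/2 ≥ τ²/4 + t²/4`, which gives the
      -- small factor and keeps an integrable one.
      rcases le_or_gt |t| τ with ht | ht
      · rw [h1 (-t) (by rwa [abs_neg])]; simp; positivity
      · have e1 : ‖χ (-t) - 1‖ ≤ 1 := by
          rw [Real.norm_eq_abs, abs_le]
          constructor <;> linarith [h0 (-t), hle (-t)]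
        have e2 : stdPhi t ≤ Real.exp (-t ^ 2 / 2) := by
          rw [stdPhi_eq]
          exact mul_le_of_le_one_left (Real.exp_nonneg _) hs
        have e3 : τ ^ 2 ≤ t ^ 2 := by rw [← sq_abs t]; gcongr
        calc stdPhi t * ‖χ (-t) - 1‖ ≤ Real.exp (-t ^ 2 / 2) * 1 := by
              gcongr
          _ ≤ Real.exp (-(τ ^ 2 / 4)) * Real.exp (-(1 / 4) * t ^ 2) := by
              rw [mul_one, ← Real.exp_add, Real.exp_le_exp]; linarith)
  rw [integral_const_mul] at hI
  rw [hnorm, norm_mul, Complex.norm_real, Real.norm_of_nonneg (inv_nonneg.2 (Real.sqrt_nonneg _))]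
  exact (mul_le_of_le_one_left (norm_nonneg _) hs).trans hI

theorem lineCharFun_scale {κ : ℝ → ℝ} {τ : ℝ} (hτ : 0 < τ) (t : ℝ) :
    lineCharFun (fun u => τ * κ (τ * u)) t = lineCharFun κ (t / τ) := by
  have h := Measure.integral_comp_mul_left
    (fun y : ℝ => (τ : ℂ) * (Complex.exp (Complex.I * ((t / τ : ℝ) : ℂ) * y) * (κ y : ℂ))) τ
  rw [integral_const_mul, abs_of_pos (inv_pos.2 hτ), Complex.real_smul, integral_const_mul, ← mul_assoc] at h
  have h1 : ((τ⁻¹ : ℝ) : ℂ) * (τ : ℂ) = 1 := by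
    rw [← Complex.ofReal_mul, inv_mul_cancel₀ hτ.ne', Complex.ofReal_one]
  rw [h1, one_mul] at h
  rw [lineCharFun, lineCharFun, ← h, ← integral_const_mul]
  congr 1; ext u
  have h2 : (τ : ℂ) ≠ 0 := by exact_mod_cast hτ.ne'
  have h3 : Complex.I * ((t / τ : ℝ) : ℂ) * ((τ * u : ℝ) : ℂ) = Complex.I * t * u := by
    push_cast; field_simp
  rw [h3]; push_cast; ring

theorem exists_abs_rpow_mul_le {f : ℝ → ℝ} (hf : Continuous f) (hs : HasCompactSupport f) {a : ℝ}
    (ha : 0 ≤ a) : ∃ C, 0 < C ∧ ∀ t, |t| ^ a * |f t| ≤ C := by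
  have hc : Continuous fun t : ℝ => |t| ^ a * |f t| :=
    (continuous_abs.rpow_const fun _ => Or.inr ha).mul hf.abs
  have hs' : HasCompactSupport fun t : ℝ => |t| ^ a * |f t| :=
    HasCompactSupport.mul_left (f := fun t : ℝ => |t| ^ a) (f' := fun t => |f t|)
      (hs.comp_left (g := fun y : ℝ => |y|) abs_zero)
  obtain ⟨C, hC⟩ := hc.bounded_above_of_compact_support hs'
  refine ⟨max C 1, by positivity, fun t => ?_⟩
  exact ((Real.le_norm_self _).trans (hC t)).trans (le_max_left _ _)

/-- Scaling a rapidly decreasing kernel stays below a density with the lower bound of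
`exists_base_density`. -/
theorem scaled_kernel_le {α c P D : ℝ} {N : ℕ} {h κ : ℝ → ℝ} (hD : 0 < D) (hc : 0 ≤ c)
    (hP : 0 ≤ P) (hN : P + |(1 - α) / 2| ≤ N) (hκ : ∀ x, |κ x| * (1 + x ^ 2) ^ N ≤ D)
    (hlow : ∀ u r : ℝ, u ≠ 0 → u ^ 2 ≤ r → c * (r ^ ((α - 1) / 2) * (1 + r) ^ (-P)) ≤ h u)
    {τ u : ℝ} (hτ : 1 ≤ τ) (hu : u ≠ 0) :
    c / (D * 2 ^ P) * τ ^ (-α) * |τ * κ (τ * u)| ≤ h u := by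
  have hτ0 : 0 < τ := by linarith
  -- The lower bound on `h` is used at `r = u² + τ^{-2}`, which stays away from zero at the scale of
  -- the kernel. Then `τ^{1-α}` splits exactly into `y^{(1-α)/2} r^{(α-1)/2}`.
  set y : ℝ := 1 + (τ * u) ^ 2 with hy
  have hy1 : 1 ≤ y := by rw [hy]; linarith [sq_nonneg (τ * u)]
  have hy0 : 0 < y := by linarith
  set r : ℝ := y / τ ^ 2 with hr
  have hr0 : 0 < r := by positivity
  have hur : u ^ 2 ≤ r := by rw [hr, le_div_iff₀ (by positivity), hy]; nlinarith
  have hry : r ≤ y := div_le_self hy0.le (by nlinarith)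
  refine le_trans ?_ (hlow u r hu hur)
  have hk : |κ (τ * u)| ≤ D * y ^ (-(N : ℝ)) := by
    rw [Real.rpow_neg hy0.le, Real.rpow_natCast, ← div_eq_mul_inv, le_div_iff₀ (by positivity)]
    exact hκ _
  have hτα : τ ^ (-α) * τ = y ^ ((1 - α) / 2) * r ^ ((α - 1) / 2) := by
    rw [hr, Real.div_rpow hy0.le (by positivity), ← mul_div_assoc, ← Real.rpow_add hy0,
      show (1 - α) / 2 + (α - 1) / 2 = 0 by ring, Real.rpow_zero, ← Real.rpow_natCast τ 2,
      ← Real.rpow_mul hτ0.le, one_div, ← Real.rpow_neg hτ0.le, ← Real.rpow_add_one hτ0.ne']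
    congr 1; push_cast; ring
  -- The decay order `N` absorbs both the power `(1 - α)/2` and `P`; since `y ≥ 1` and `y ≥ r`, one
  -- has `y ≥ (1 + r)/2`.
  have hyP : y ^ ((1 - α) / 2) * y ^ (-(N : ℝ)) ≤ 2 ^ P * (1 + r) ^ (-P) := by
    rw [← Real.rpow_add hy0]
    calc y ^ ((1 - α) / 2 + -(N : ℝ)) ≤ y ^ (-P) := by
          refine Real.rpow_le_rpow_of_exponent_le hy1 ?_
          have := le_abs_self ((1 - α) / 2)
          linarith
      _ ≤ ((1 + r) / 2) ^ (-P) :=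
          Real.rpow_le_rpow_of_nonpos (by positivity) (by linarith) (by linarith)
      _ = 2 ^ P * (1 + r) ^ (-P) := by
          rw [Real.div_rpow (by positivity) (by norm_num), Real.rpow_neg (by norm_num : (0:ℝ) ≤ 2),
            div_inv_eq_mul, mul_comm]
  calc c / (D * 2 ^ P) * τ ^ (-α) * |τ * κ (τ * u)|
      = c / (D * 2 ^ P) * (τ ^ (-α) * τ) * |κ (τ * u)| := by
        rw [abs_mul, abs_of_pos hτ0]; ring
    _ ≤ c / (D * 2 ^ P) * (τ ^ (-α) * τ) * (D * y ^ (-(N : ℝ))) := by gcongr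
    _ = c / (D * 2 ^ P) * D * r ^ ((α - 1) / 2) * (y ^ ((1 - α) / 2) * y ^ (-(N : ℝ))) := by
        rw [hτα]; ring
    _ ≤ c / (D * 2 ^ P) * D * r ^ ((α - 1) / 2) * (2 ^ P * (1 + r) ^ (-P)) := by gcongr
    _ = c * (r ^ ((α - 1) / 2) * (1 + r) ^ (-P)) := by field_simp

/-- A density `h₀` with decaying characteristic function, together with perturbations of relative
size `τ^(-α)` which are invisible after Gaussian smoothing up to a point mass. -/
theorem exists_perturbation {α A q : ℝ} (hα : 0 < α) (hA : 0 < A) (hq : 1 ≤ q) :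
    ∃ (h₀ : ℝ → ℝ) (θ B : ℝ), 0 < θ ∧ θ ≤ 1 ∧ 0 < B ∧ IsDecayDensity α A h₀ ∧
      ∫⁻ u, ENNReal.ofReal (|u| ^ q * h₀ u) < ∞ ∧
      ∀ τ : ℝ, 1 ≤ τ → ∃ h₁ : ℝ → ℝ, IsDecayDensity α A h₁ ∧ (∀ᵐ u, h₁ u ≤ 2 * h₀ u) ∧
        ∀ x, |(1 + θ * τ ^ (-α)) * gaussSmooth h₁ x - gaussSmooth h₀ x - θ * τ ^ (-α) * stdPhi x| ≤
          B * Real.exp (-(τ ^ 2 / 4)) := by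
  obtain ⟨κ, χ, hκc, hκD, hκχ, hχ1, hχs, hχone, hχ0, hχle⟩ := exists_flat_kernel
  -- The base density uses half of the decay budget `A`; the other half is left for the kernel.
  obtain ⟨h₀, c, P, hc, hP, hm, h0, hi, hint, hmom, hdec, hlow⟩ :=
    exists_base_density (q := q) hα (half_pos hA) hq
  obtain ⟨N, hN⟩ := exists_nat_ge (P + |(1 - α) / 2|)
  obtain ⟨D, hD, hDκ⟩ := hκD N
  obtain ⟨D1, hD1, hDκ1⟩ := hκD 1
  obtain ⟨C1, hC1, hCχ⟩ := exists_abs_rpow_mul_le hχ1.continuous hχs hα.le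
  obtain ⟨C2, hC2, hCχ'⟩ := exists_abs_rpow_mul_le (hχ1.continuous_deriv le_rfl) hχs.deriv
    (by linarith : 0 ≤ α + 1)
  have hκi : Integrable κ := by
    refine (integrable_inv_one_add_sq.const_mul D1).mono' hκc.aestronglyMeasurable
      (ae_of_all _ fun x => ?_)
    have := hDκ1 x
    rw [pow_one] at this
    rw [Real.norm_eq_abs, ← div_eq_mul_inv, le_div_iff₀ (by positivity)]
    exact this
  -- The three terms ensure in turn that `s ≤ 1`, that `s |k| ≤ h₀` away from zero, and that the
  -- scaled cutoff and its derivative stay within the remaining budget `A / 2`.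
  set θ : ℝ := min 1 (min (c / (D * 2 ^ P)) (A / 2 / (C1 + C2))) with hθ
  have hθ0 : 0 < θ := by rw [hθ]; positivity
  have hθ1 : θ ≤ 1 := min_le_left _ _
  have hθc : θ ≤ c / (D * 2 ^ P) := (min_le_right _ _).trans (min_le_left _ _)
  have hθC : θ * (C1 + C2) ≤ A / 2 := by
    rw [← le_div_iff₀ (by positivity)]
    exact (min_le_right _ _).trans (min_le_right _ _)
  have hθC1 : θ * C1 ≤ A / 2 := by nlinarith
  have hθC2 : θ * C2 ≤ A / 2 := by nlinarith
  set G : ℝ := ∫ t : ℝ, Real.exp (-(1 / 4) * t ^ 2) with hG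
  have hGpos : 0 ≤ G := integral_nonneg fun t => Real.exp_nonneg _
  refine ⟨h₀, θ, G + 1, hθ0, hθ1, by positivity, ⟨hm, h0, hi, hint,
    fun t => (hdec t).1.trans (by linarith), fun t => (hdec t).2.1,
    fun t => (hdec t).2.2.trans (by linarith)⟩, hmom, fun τ hτ => ?_⟩
  have hτ0 : 0 < τ := by linarith
  obtain ⟨s, hs⟩ : ∃ s : ℝ, s = θ * τ ^ (-α) := ⟨_, rfl⟩
  simp_rw [← hs]
  have hs0 : 0 < s := by rw [hs]; positivity
  have hs1 : s ≤ 1 := by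
    have : τ ^ (-α) ≤ 1 := Real.rpow_le_one_of_one_le_of_nonpos hτ (by linarith)
    rw [hs]; exact mul_le_one₀ hθ1 (by positivity) this
  set k : ℝ → ℝ := fun u => τ * κ (τ * u) with hk
  have hkm : Measurable k := (hκc.measurable.comp (measurable_const_mul τ)).const_mul τ
  have hki : Integrable k := (hκi.comp_mul_left' hτ0.ne').const_mul τ
  have hkcf : ∀ t, lineCharFun k t = (χ (t / τ) : ℂ) := fun t => by
    rw [hk, lineCharFun_scale hτ0, hκχ]
  have hdom : ∀ u, u ≠ 0 → s * |k u| ≤ h₀ u := by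
    intro u hu
    refine le_trans ?_ (scaled_kernel_le hD hc.le hP hN hDκ hlow hτ hu)
    rw [hs]; gcongr
  -- The domination of `s |k|` is known only for `u ≠ 0`. The maximum makes `h₁` nonnegative
  -- everywhere and changes nothing off this null set.
  set h₁ : ℝ → ℝ := fun u => max 0 ((1 + s)⁻¹ * (h₀ u + s * k u)) with hh₁
  have hs1' : 0 < 1 + s := by linarith
  have hinv1 : (1 + s)⁻¹ ≤ 1 := inv_le_one_of_one_le₀ (by linarith)
  have heq : ∀ u, u ≠ 0 → h₁ u = (1 + s)⁻¹ * (h₀ u + s * k u) := by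
    intro u hu
    refine max_eq_right (mul_nonneg (by positivity) ?_)
    have h1 := hdom u hu
    have h2 : -(s * |k u|) ≤ s * k u := by
      rw [← mul_neg]; exact mul_le_mul_of_nonneg_left (neg_abs_le _) hs0.le
    linarith
  have hne : ∀ᵐ u : ℝ, u ≠ 0 := by
    rw [ae_iff]; simp
  have hae : h₁ =ᵐ[volume] fun u => (1 + s)⁻¹ * (h₀ u + s * k u) := hne.mono heq
  have hlin : Integrable fun u => (1 + s)⁻¹ * (h₀ u + s * k u) :=
    (hi.add (hki.const_mul s)).const_mul _
  have hcf : ∀ t, lineCharFun h₁ t =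
      ((1 + s)⁻¹ : ℝ) * (lineCharFun h₀ t + ((s * χ (t / τ) : ℝ) : ℂ)) := by
    intro t
    have e : lineCharFun h₁ t = ∫ u : ℝ, (((1 + s)⁻¹ : ℝ) : ℂ) *
        (Complex.exp (Complex.I * t * u) * (h₀ u : ℂ) +
          (s : ℂ) * (Complex.exp (Complex.I * t * u) * (k u : ℂ))) := by
      refine integral_congr_ae (hae.mono fun u hu => ?_)
      simp only
      rw [hu]; push_cast; ring
    rw [e, integral_const_mul, integral_add (integrable_exp_mul hi t)
      ((integrable_exp_mul hki t).const_mul _), integral_const_mul, Complex.ofReal_mul, ← hkcf]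
    rfl
  have hχd : ∀ t, HasDerivAt (fun t : ℝ => ((s * χ (t / τ) : ℝ) : ℂ))
      ((s * (deriv χ (t / τ) * (1 / τ)) : ℝ) : ℂ) t := by
    intro t
    have h1 : HasDerivAt χ (deriv χ (t / τ)) (t / τ) :=
      (hχ1.differentiable one_ne_zero (t / τ)).hasDerivAt
    have h2 : HasDerivAt (fun t : ℝ => t / τ) (1 / τ) t := (hasDerivAt_id t).div_const τ
    exact ((h1.comp t h2).const_mul s).ofReal_comp
  have hd : ∀ t, HasDerivAt (lineCharFun h₁) (((1 + s)⁻¹ : ℝ) *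
      (deriv (lineCharFun h₀) t + ((s * (deriv χ (t / τ) * (1 / τ)) : ℝ) : ℂ))) t := by
    intro t
    rw [funext hcf]
    exact ((hdec t).2.1.hasDerivAt.add (hχd t)).const_mul _
  have hχbd : ∀ t, |t| ^ α * (s * χ (t / τ)) ≤ A / 2 := by
    intro t
    have h1 := hCχ (t / τ)
    rw [abs_of_nonneg (hχ0 _), abs_div, abs_of_pos hτ0,
      Real.div_rpow (abs_nonneg t) hτ0.le, div_eq_mul_inv, ← Real.rpow_neg hτ0.le] at h1
    calc |t| ^ α * (s * χ (t / τ)) = θ * (|t| ^ α * τ ^ (-α) * χ (t / τ)) := by rw [hs]; ring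
      _ ≤ θ * C1 := by gcongr
      _ ≤ A / 2 := hθC1
  have hχbd' : ∀ t, |t| ^ (α + 1) * (s * (|deriv χ (t / τ)| * (1 / τ))) ≤ A / 2 := by
    intro t
    have h1 := hCχ' (t / τ)
    rw [abs_div, abs_of_pos hτ0, Real.div_rpow (abs_nonneg t) hτ0.le, div_eq_mul_inv,
      ← Real.rpow_neg hτ0.le, neg_add, Real.rpow_add hτ0, Real.rpow_neg_one] at h1
    calc |t| ^ (α + 1) * (s * (|deriv χ (t / τ)| * (1 / τ)))
        = θ * (|t| ^ (α + 1) * (τ ^ (-α) * τ⁻¹) * |deriv χ (t / τ)|) := by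
          rw [hs, one_div]; ring
      _ ≤ θ * C2 := by gcongr
      _ ≤ A / 2 := hθC2
  refine ⟨h₁, ⟨?_, fun u => le_max_left _ _, hlin.congr hae.symm, ?_, fun t => ?_,
    fun t => (hd t).differentiableAt, fun t => ?_⟩, ?_, fun x => ?_⟩
  · exact measurable_const.max ((hm.add (hkm.const_mul s)).const_mul _)
  · have hk1 : ∫ u, k u = 1 := by
      have h := hkcf 0
      simp only [lineCharFun, Complex.ofReal_zero, mul_zero, zero_mul, Complex.exp_zero, one_mul,
        zero_div] at h
      rw [integral_complex_ofReal] at h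
      rw [Complex.ofReal_injective h, hχone 0 (by simp)]
    rw [integral_congr_ae hae, integral_const_mul, integral_add hi (hki.const_mul s),
      integral_const_mul, hint, hk1, mul_one, inv_mul_cancel₀ hs1'.ne']
  · rw [hcf, norm_mul, Complex.norm_real, Real.norm_of_nonneg (by positivity)]
    have h1 : ‖lineCharFun h₀ t + ((s * χ (t / τ) : ℝ) : ℂ)‖ ≤
        ‖lineCharFun h₀ t‖ + s * χ (t / τ) := by
      refine (norm_add_le _ _).trans (le_of_eq ?_)
      rw [Complex.norm_real, Real.norm_of_nonneg (mul_nonneg hs0.le (hχ0 _))]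
    calc |t| ^ α * ((1 + s)⁻¹ * ‖lineCharFun h₀ t + ((s * χ (t / τ) : ℝ) : ℂ)‖)
        ≤ |t| ^ α * (1 * (‖lineCharFun h₀ t‖ + s * χ (t / τ))) := by gcongr
      _ = |t| ^ α * ‖lineCharFun h₀ t‖ + |t| ^ α * (s * χ (t / τ)) := by ring
      _ ≤ A := by linarith [(hdec t).1, hχbd t]
  · rw [(hd t).deriv, norm_mul, Complex.norm_real, Real.norm_of_nonneg (by positivity)]
    have h1 : ‖deriv (lineCharFun h₀) t + ((s * (deriv χ (t / τ) * (1 / τ)) : ℝ) : ℂ)‖ ≤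
        ‖deriv (lineCharFun h₀) t‖ + s * (|deriv χ (t / τ)| * (1 / τ)) := by
      refine (norm_add_le _ _).trans (le_of_eq ?_)
      rw [Complex.norm_real, norm_mul, norm_mul, Real.norm_of_nonneg hs0.le, Real.norm_eq_abs,
        Real.norm_of_nonneg (by positivity : 0 ≤ 1 / τ)]
    calc |t| ^ (α + 1) * ((1 + s)⁻¹ *
          ‖deriv (lineCharFun h₀) t + ((s * (deriv χ (t / τ) * (1 / τ)) : ℝ) : ℂ)‖)
        ≤ |t| ^ (α + 1) * (1 *
          (‖deriv (lineCharFun h₀) t‖ + s * (|deriv χ (t / τ)| * (1 / τ)))) := by gcongr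
      _ = |t| ^ (α + 1) * ‖deriv (lineCharFun h₀) t‖ +
          |t| ^ (α + 1) * (s * (|deriv χ (t / τ)| * (1 / τ))) := by ring
      _ ≤ A := by linarith [(hdec t).2.2, hχbd' t]
  · filter_upwards [hne] with u hu
    rw [heq u hu]
    have h1 := hdom u hu
    have h2 : s * k u ≤ s * |k u| := mul_le_mul_of_nonneg_left (le_abs_self _) hs0.le
    have h3 : -(s * |k u|) ≤ s * k u := by
      rw [← mul_neg]; exact mul_le_mul_of_nonneg_left (neg_abs_le _) hs0.le
    calc (1 + s)⁻¹ * (h₀ u + s * k u) ≤ 1 * (h₀ u + s * k u) :=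
          mul_le_mul_of_nonneg_right hinv1 (by linarith)
      _ ≤ 2 * h₀ u := by linarith
  · have e : gaussSmooth h₁ x = (1 + s)⁻¹ * (gaussSmooth h₀ x + s * gaussSmooth k x) := by
      have e1 : gaussSmooth h₁ x = ∫ u, (1 + s)⁻¹ * (h₀ u * stdPhi (x - u) +
          s * (k u * stdPhi (x - u))) := by
        refine integral_congr_ae (hae.mono fun u hu => ?_)
        simp only
        rw [hu]; ring
      rw [e1, integral_const_mul, integral_add (integrable_mul_stdPhi hi x)
        ((integrable_mul_stdPhi hki x).const_mul s), integral_const_mul]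
      rfl
    -- The base density cancels; what remains is the smoothed kernel against a smoothed point mass
    -- at zero.
    have e2 : (1 + s) * gaussSmooth h₁ x - gaussSmooth h₀ x - s * stdPhi x =
        s * (gaussSmooth k x - stdPhi x) := by
      rw [e, mul_inv_cancel_left₀ hs1'.ne']; ring
    have h1 := abs_gaussSmooth_sub_stdPhi_le (χ := fun t => χ (t / τ)) hki
      (hχ1.continuous.measurable.comp (measurable_id.div_const τ)) hkcf hτ0.le
      (fun t ht => hχone _ (by
        rw [abs_div, abs_of_pos hτ0, div_le_one hτ0]; exact ht))
      (fun t => hχ0 _) (fun t => hχle _) x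
    rw [e2, abs_mul, abs_of_pos hs0]
    calc s * |gaussSmooth k x - stdPhi x| ≤ 1 * (Real.exp (-(τ ^ 2 / 4)) * G) := by gcongr
      _ ≤ (G + 1) * Real.exp (-(τ ^ 2 / 4)) := by
          have := Real.exp_nonneg (-(τ ^ 2 / 4)); nlinarith

/-! ### Membership in the parameter space -/

/-- The mixing law with `u`-density `h` and `σ = 1`. -/
def unitMixingLaw (h : ℝ → ℝ) : Measure (ℝ × ℝ) :=
  ((volume : Measure ℝ).withDensity fun u => ENNReal.ofReal (h u)).prod (Measure.dirac 1)

section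

variable {α A q : ℝ} {h : ℝ → ℝ}

theorem IsDecayDensity.lintegral_eq (hh : IsDecayDensity α A h) :
    ∫⁻ u, ENNReal.ofReal (h u) = 1 := by
  rw [← ofReal_integral_eq_lintegral_ofReal hh.integrable (ae_of_all _ hh.nonneg), hh.integral_eq,
    ENNReal.ofReal_one]

theorem IsDecayDensity.isProbabilityMeasure (hh : IsDecayDensity α A h) :
    IsProbabilityMeasure ((volume : Measure ℝ).withDensity fun u => ENNReal.ofReal (h u)) :=
  ⟨by simp [hh.lintegral_eq]⟩

/-- Taking the conditional density independent of `σ` meets the requirements at every `σ ≥ 1`,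
although the `σ`-marginal charges only `1`. -/
theorem IsDecayDensity.isMixingLaw (hh : IsDecayDensity α A h) :
    IsMixingLaw (unitMixingLaw h) (fun u _ => h u) := by
  have := hh.isProbabilityMeasure
  have hsnd : (unitMixingLaw h).snd = Measure.dirac 1 := by
    rw [unitMixingLaw, Measure.snd_prod]
  refine ⟨?_, ?_, hh.measurable.comp measurable_fst, fun u _ => hh.nonneg u,
    fun _ _ => hh.lintegral_eq, ?_⟩
  · rw [unitMixingLaw]; infer_instance
  · rw [hsnd, Measure.dirac_apply' _ measurableSet_Iio]; simp
  · rw [hsnd, unitMixingLaw, prod_withDensity_left hh.measurable.ennreal_ofReal]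

theorem IsDecayDensity.hasDecay (hh : IsDecayDensity α A h) (T : ℝ → ℝ) (d : Bool) :
    HasDecay α A T d (fun u _ => h u) := by
  intro δ hδ t _ σ _
  exact ⟨(hh.decay t).trans (by linarith),
    fun _ => ⟨hh.differentiable t, (hh.decay_deriv t).trans (by linarith)⟩⟩

theorem IsDecayDensity.mixtureDensity_eq (hh : IsDecayDensity α A h) (ε x : ℝ) :
    mixtureDensity ε (unitMixingLaw h) x = (1 - ε) * stdPhi x + ε * gaussSmooth h x := by
  have := hh.isProbabilityMeasure
  have hm : Measurable fun p : ℝ × ℝ => component p x :=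
    measurable_component.comp (by fun_prop : Measurable fun p : ℝ × ℝ => (p, x))
  rw [ProportionEstimation.mixtureDensity_eq]
  congr 2
  have hi := hh.isMixingLaw.integrable_component x
  rw [unitMixingLaw] at hi ⊢
  rw [integral_prod _ hi]
  simp only [integral_dirac]
  rw [integral_withDensity_eq_integral_toReal_smul hh.measurable.ennreal_ofReal
    (ae_of_all _ fun _ => ENNReal.ofReal_lt_top), gaussSmooth]
  congr 1; ext u
  rw [ENNReal.toReal_ofReal (hh.nonneg u), smul_eq_mul, component]
  simp

theorem gaussSmooth_nonneg (h0 : ∀ u, 0 ≤ h u) (x : ℝ) : 0 ≤ gaussSmooth h x :=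
  integral_nonneg fun u => mul_nonneg (h0 u) (stdPhi_nonneg _)

theorem measurable_gaussSmooth (hm : Measurable h) : Measurable (gaussSmooth h) := by
  refine (StronglyMeasurable.integral_prod_right (f := fun (x u : ℝ) => h u * stdPhi (x - u))
    (Measurable.stronglyMeasurable ?_)).measurable
  exact (hm.comp measurable_snd).mul
    (measurable_stdPhi.comp (measurable_fst.sub measurable_snd))

theorem absMoment_eq (hq : 0 < q) :
    ∫⁻ x, ENNReal.ofReal (|x| ^ q * stdPhi x) = ENNReal.ofReal (absMoment q) := by
  have hfin := lintegral_abs_rpow_gaussianReal_lt_top q hq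
  have h1 : ∫⁻ x, ENNReal.ofReal (|x| ^ q * stdPhi x) =
      ∫⁻ z, ENNReal.ofReal (|z| ^ q) ∂(gaussianReal 0 1) := by
    have := lintegral_abs_rpow_centredPDF (v := 1) (q := q) one_pos
    simpa [centredPDF, stdPhi] using this
  have hint : Integrable (fun x : ℝ => |x| ^ q) (gaussianReal 0 1) := by
    refine ⟨(by fun_prop : Measurable fun x : ℝ => |x| ^ q).aestronglyMeasurable, ?_⟩
    rw [hasFiniteIntegral_iff_ofReal (ae_of_all _ fun x => by positivity)]
    exact hfin
  rw [h1, absMoment, ofReal_integral_eq_lintegral_ofReal hint (ae_of_all _ fun x => by positivity)]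

/-- Moments of a smoothed density. -/
theorem lintegral_abs_rpow_gaussSmooth_le (hq : 1 ≤ q) (hm : Measurable h) (h0 : ∀ u, 0 ≤ h u)
    (h1 : ∫⁻ u, ENNReal.ofReal (h u) = 1) :
    ∫⁻ x, ENNReal.ofReal (|x| ^ q * gaussSmooth h x) ≤
      ENNReal.ofReal (2 ^ (q - 1)) *
        (ENNReal.ofReal (absMoment q) + ∫⁻ u, ENNReal.ofReal (|u| ^ q * h u)) := by
  have hq0 : 0 < q := by linarith
  have hφ1 : ∫⁻ z, ENNReal.ofReal (stdPhi z) = 1 :=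
    lintegral_gaussianPDFReal_eq_one 0 one_ne_zero
  have hmeas : Measurable fun z : ℝ × ℝ =>
      ENNReal.ofReal (|z.1| ^ q) * ENNReal.ofReal (h z.2 * stdPhi (z.1 - z.2)) :=
    Measurable.mul (by fun_prop) ((hm.comp measurable_snd).mul
      (measurable_stdPhi.comp (measurable_fst.sub measurable_snd))).ennreal_ofReal
  have hinner : ∀ u, ∫⁻ x, ENNReal.ofReal (|x| ^ q) * ENNReal.ofReal (h u * stdPhi (x - u)) ≤
      ENNReal.ofReal (2 ^ (q - 1)) * (ENNReal.ofReal (absMoment q) * ENNReal.ofReal (h u) +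
        ENNReal.ofReal (|u| ^ q * h u)) := by
    intro u
    have hu := h0 u
    calc ∫⁻ x, ENNReal.ofReal (|x| ^ q) * ENNReal.ofReal (h u * stdPhi (x - u))
        = ∫⁻ z, ENNReal.ofReal (|z + u| ^ q) * ENNReal.ofReal (h u * stdPhi z) := by
          rw [← lintegral_add_right_eq_self _ u]
          simp only [add_sub_cancel_right]
      _ ≤ ∫⁻ z, ENNReal.ofReal (2 ^ (q - 1)) * (ENNReal.ofReal (|z| ^ q * stdPhi z) *
            ENNReal.ofReal (h u) + ENNReal.ofReal (stdPhi z) * ENNReal.ofReal (|u| ^ q * h u)) := by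
          refine lintegral_mono fun z => ?_
          have hz := stdPhi_nonneg z
          rw [← ENNReal.ofReal_mul (by positivity), ← ENNReal.ofReal_mul (by positivity),
            ← ENNReal.ofReal_mul (by positivity), ← ENNReal.ofReal_add (by positivity)
            (by positivity), ← ENNReal.ofReal_mul (by positivity)]
          apply ENNReal.ofReal_le_ofReal
          -- Convexity of `x ↦ x^q` for `q ≥ 1`.
          have hc : |z + u| ^ q ≤ 2 ^ (q - 1) * (|z| ^ q + |u| ^ q) := by
            refine (Real.rpow_le_rpow (abs_nonneg _) (abs_add_le z u) hq0.le).trans ?_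
            exact_mod_cast NNReal.rpow_add_le_mul_rpow_add_rpow (Real.nnabs z) (Real.nnabs u) hq
          calc |z + u| ^ q * (h u * stdPhi z)
              ≤ 2 ^ (q - 1) * (|z| ^ q + |u| ^ q) * (h u * stdPhi z) := by gcongr
            _ = _ := by ring
      _ = _ := by
          rw [lintegral_const_mul' _ _ ENNReal.ofReal_ne_top,
            lintegral_add_left (by fun_prop), lintegral_mul_const' _ _ ENNReal.ofReal_ne_top,
            lintegral_mul_const' _ _ ENNReal.ofReal_ne_top, hφ1, absMoment_eq hq0, one_mul]
  calc ∫⁻ x, ENNReal.ofReal (|x| ^ q * gaussSmooth h x)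
      ≤ ∫⁻ x, ∫⁻ u, ENNReal.ofReal (|x| ^ q) * ENNReal.ofReal (h u * stdPhi (x - u)) := by
        refine lintegral_mono fun x => ?_
        simp only
        rw [ENNReal.ofReal_mul (by positivity), lintegral_const_mul' _ _ ENNReal.ofReal_ne_top]
        gcongr
        refine (Real.ofReal_le_enorm _).trans
          ((enorm_integral_le_lintegral_enorm _).trans (le_of_eq ?_))
        congr 1; ext u
        exact Real.enorm_of_nonneg (mul_nonneg (h0 u) (stdPhi_nonneg _))
    _ = ∫⁻ u, ∫⁻ x, ENNReal.ofReal (|x| ^ q) * ENNReal.ofReal (h u * stdPhi (x - u)) :=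
        lintegral_lintegral_swap hmeas.aemeasurable
    _ ≤ ∫⁻ u, ENNReal.ofReal (2 ^ (q - 1)) * (ENNReal.ofReal (absMoment q) * ENNReal.ofReal (h u) +
        ENNReal.ofReal (|u| ^ q * h u)) := lintegral_mono hinner
    _ = _ := by
        rw [lintegral_const_mul' _ _ ENNReal.ofReal_ne_top,
          lintegral_add_left (hm.ennreal_ofReal.const_mul _),
          lintegral_const_mul' _ _ ENNReal.ofReal_ne_top, h1, mul_one]

/-- Membership in the parameter space for small proportions. -/
theorem IsDecayDensity.mem_paramSpace {β ε₀ ε M : ℝ} {n : ℕ} (hh : IsDecayDensity α A h)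
    (hq : 0 < q) (h0 : 0 ≤ ε) (hε : ε ≤ ε₀ * (n : ℝ) ^ (-β))
    (hM : ∫⁻ x, ENNReal.ofReal (|x| ^ q * gaussSmooth h x) ≤ ENNReal.ofReal M)
    (hA : absMoment q + ε * M ≤ A ^ q) (hM0 : 0 ≤ M) (T : ℝ → ℝ) (d : Bool) :
    (ε, mixtureDensity ε (unitMixingLaw h)) ∈ paramSpace α β ε₀ q A T d n := by
  refine ⟨h0, hε, ⟨unitMixingLaw h, fun u _ => h u, hh.isMixingLaw, hh.hasDecay T d, rfl⟩, ?_⟩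
  have hmom : 0 ≤ absMoment q := integral_nonneg fun x => by positivity
  calc ∫⁻ x : ℝ, ENNReal.ofReal (|x| ^ q * mixtureDensity ε (unitMixingLaw h) x)
      ≤ ∫⁻ x : ℝ, (ENNReal.ofReal (|x| ^ q * stdPhi x) +
          ENNReal.ofReal ε * ENNReal.ofReal (|x| ^ q * gaussSmooth h x)) := by
        refine lintegral_mono fun x => ?_
        have hφ := stdPhi_nonneg x
        have hs := gaussSmooth_nonneg hh.nonneg x
        rw [hh.mixtureDensity_eq, ← ENNReal.ofReal_mul h0, ← ENNReal.ofReal_add (by positivity)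
          (by positivity)]
        apply ENNReal.ofReal_le_ofReal
        have : 0 ≤ |x| ^ q * (ε * stdPhi x) := by positivity
        linarith
    _ = ENNReal.ofReal (absMoment q) +
          ENNReal.ofReal ε * ∫⁻ x, ENNReal.ofReal (|x| ^ q * gaussSmooth h x) := by
        rw [lintegral_add_left (by fun_prop), lintegral_const_mul' _ _ ENNReal.ofReal_ne_top,
          absMoment_eq hq]
    _ ≤ ENNReal.ofReal (absMoment q) + ENNReal.ofReal ε * ENNReal.ofReal M := by gcongr
    _ = ENNReal.ofReal (absMoment q + ε * M) := by
        rw [← ENNReal.ofReal_mul h0, ENNReal.ofReal_add hmom (by positivity)]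
    _ ≤ _ := ENNReal.ofReal_le_ofReal hA

end

/-! ### Affinity and the minimax lower bound -/

/-- The affinity of two densities with bounded `q`-th moments which are uniformly close. -/
theorem one_sub_le_lintegral_min {f g : ℝ → ℝ} {q B S R : ℝ} (hq : 0 < q) (hB : 0 ≤ B) (hR : 0 < R)
    (hS : 0 ≤ S) (hfm : Measurable f) (hgm : Measurable g) (hf0 : ∀ x, 0 ≤ f x)
    (hg0 : ∀ x, 0 ≤ g x) (hf1 : ∫⁻ x, ENNReal.ofReal (f x) = 1)
    (hfB : ∫⁻ x, ENNReal.ofReal (|x| ^ q * f x) ≤ ENNReal.ofReal B)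
    (hfg : ∀ x, |g x - f x| ≤ S) :
    ENNReal.ofReal (1 - (2 * R * S + B / R ^ q)) ≤ ∫⁻ x, ENNReal.ofReal (min (f x) (g x)) := by
  have hRq : 0 < R ^ q := by positivity
  -- On `[-R, R]` the loss is at most the uniform distance `S`; outside it, `f x ≤ |x|^q f x / R^q`.
  have hpt : ∀ x, ENNReal.ofReal (f x) ≤ ENNReal.ofReal (min (f x) (g x)) +
      ((Set.Icc (-R) R).indicator (fun _ => ENNReal.ofReal S) x +
        ENNReal.ofReal (R ^ q)⁻¹ * ENNReal.ofReal (|x| ^ q * f x)) := by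
    intro x
    by_cases hx : x ∈ Set.Icc (-R) R
    · rw [Set.indicator_of_mem hx]
      have h1 : f x ≤ min (f x) (g x) + S := by
        rcases le_total (f x) (g x) with h | h
        · rw [min_eq_left h]; linarith
        · rw [min_eq_right h]; linarith [neg_abs_le (g x - f x), hfg x]
      calc ENNReal.ofReal (f x) ≤ ENNReal.ofReal (min (f x) (g x) + S) :=
            ENNReal.ofReal_le_ofReal h1
        _ = ENNReal.ofReal (min (f x) (g x)) + ENNReal.ofReal S :=
            ENNReal.ofReal_add (le_min (hf0 x) (hg0 x)) hS
        _ ≤ _ := by gcongr; exact le_self_add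
    · have hx' : R ≤ |x| := by
        by_contra! hlt
        exact hx (abs_le.1 hlt.le)
      rw [Set.indicator_of_notMem hx, zero_add, ← ENNReal.ofReal_mul (by positivity)]
      refine le_trans (ENNReal.ofReal_le_ofReal ?_) le_add_self
      rw [← mul_assoc]
      refine le_mul_of_one_le_left (hf0 x) ?_
      rw [inv_mul_eq_div, one_le_div hRq]
      exact Real.rpow_le_rpow hR.le hx' hq.le
  have hsum := lintegral_mono hpt (μ := volume)
  rw [hf1, lintegral_add_left (hfm.min hgm).ennreal_ofReal,
    lintegral_add_left (measurable_const.indicator measurableSet_Icc),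
    lintegral_const_mul' _ _ ENNReal.ofReal_ne_top, lintegral_indicator measurableSet_Icc,
    setLIntegral_const, Real.volume_Icc] at hsum
  have hrest : ENNReal.ofReal S * ENNReal.ofReal (R - -R) +
      ENNReal.ofReal (R ^ q)⁻¹ * ∫⁻ x, ENNReal.ofReal (|x| ^ q * f x) ≤
      ENNReal.ofReal (2 * R * S + B / R ^ q) := by
    calc _ ≤ ENNReal.ofReal S * ENNReal.ofReal (R - -R) +
          ENNReal.ofReal (R ^ q)⁻¹ * ENNReal.ofReal B := by gcongr
      _ = _ := by
        rw [← ENNReal.ofReal_mul hS, ← ENNReal.ofReal_mul (by positivity),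
          ← ENNReal.ofReal_add (by nlinarith) (by positivity)]
        congr 1; rw [div_eq_inv_mul]; ring
  rw [ENNReal.ofReal_sub _ (by positivity), ENNReal.ofReal_one, tsub_le_iff_right]
  exact hsum.trans (by gcongr)

theorem absMoment_nonneg (q : ℝ) : 0 ≤ absMoment q := integral_nonneg fun x => by positivity

/-- Room above the null moment is all the lower bound needs; the factor `√2 ≥ 1` is discarded. -/
theorem absMoment_lt_rpow {q A : ℝ} (hq : 0 < q) (hA : √2 * absMoment q ^ (1 / q) < A) :
    absMoment q < A ^ q := by
  have h0 := absMoment_nonneg q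
  have h1 : absMoment q ^ (1 / q) < A := by
    refine lt_of_le_of_lt (le_mul_of_one_le_left (by positivity) ?_) hA
    rw [Real.one_le_sqrt]; norm_num
  have h2 := Real.rpow_lt_rpow (by positivity) h1 hq
  rwa [← Real.rpow_mul h0, one_div_mul_cancel hq.ne', Real.rpow_one] at h2

/-- This is the affinity loss for window `R = n` and uniform distance `B n^{-4}`. Each term is at
most `1/(4n)`; the tail term uses `q ≥ 2`. -/
theorem affinity_defect_le {n q B D : ℝ} (hq : 2 ≤ q) (hB : 0 ≤ B) (hD : 0 ≤ D)
    (hn : 8 * B + 4 * D + 1 ≤ n) :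
    2 * n * (B * (n ^ 4)⁻¹) + D / n ^ q ≤ 1 / (2 * n) := by
  have hn1 : 1 ≤ n := by linarith
  have hn0 : 0 < n := by linarith
  have h1 : 2 * n * (B * (n ^ 4)⁻¹) ≤ 1 / (4 * n) := by
    have e : 2 * n * (B * (n ^ 4)⁻¹) = 2 * B / n ^ 3 := by field_simp
    rw [e, div_le_div_iff₀ (by positivity) (by positivity)]
    have h8 : 8 * B * n ≤ n ^ 2 * n := by
      gcongr
      nlinarith
    calc 2 * B * (4 * n) = 8 * B * n := by ring
      _ ≤ n ^ 2 * n := h8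
      _ = 1 * n ^ 3 := by ring
  have h2 : D / n ^ q ≤ 1 / (4 * n) := by
    have h3 : n ^ 2 ≤ n ^ q := by
      rw [← Real.rpow_natCast]
      exact Real.rpow_le_rpow_of_exponent_le hn1 (by exact_mod_cast hq)
    calc D / n ^ q ≤ D / n ^ 2 := by gcongr
      _ ≤ 1 / (4 * n) := by
        rw [div_le_div_iff₀ (by positivity) (by positivity)]
        nlinarith
  have h3 : 1 / (4 * n) + 1 / (4 * n) = 1 / (2 * n) := by field_simp; norm_num
  linarith

/-- The minimax lower bound over the class. -/
theorem exists_le_minimaxRisk {α β ε₀ q A : ℝ} (hα : 0 < α) (hβ0 : 0 ≤ β) (hε0 : 0 < ε₀)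
    (hε1 : ε₀ < 1) (hq : 2 ≤ q) (hA : √2 * absMoment q ^ (1 / q) < A) (T : ℝ → ℝ) (d : Bool) :
    ∃ c : ℝ, 0 < c ∧ ∀ᶠ n : ℕ in atTop,
      ENNReal.ofReal (c * rate α β n) ≤ minimaxRisk n (paramSpace α β ε₀ q A T d n) := by
  have hq0 : 0 < q := by linarith
  have hM0 := absMoment_nonneg q
  have hA0 : 0 < A := lt_of_le_of_lt (by positivity) hA
  have hgap : 0 < A ^ q - absMoment q := sub_pos.2 (absMoment_lt_rpow hq0 hA)
  obtain ⟨h₀, θ, B, hθ0, hθ1, hB, hh₀, hmom, hpert⟩ :=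
    exists_perturbation (q := q) hα hA0 (by linarith)
  set m₀ := ∫⁻ u, ENNReal.ofReal (|u| ^ q * h₀ u) with hm₀
  -- The factor `2` covers both `h₀` and every perturbation `h₁ ≤ 2 h₀`, so one moment bound serves
  -- for all `τ`, hence for all `n`.
  set Me := ENNReal.ofReal (2 ^ (q - 1)) * (ENNReal.ofReal (absMoment q) + 2 * m₀) with hMe
  have hMtop : Me ≠ ∞ := ENNReal.mul_ne_top ENNReal.ofReal_ne_top
    (ENNReal.add_ne_top.2 ⟨ENNReal.ofReal_ne_top, ENNReal.mul_ne_top (by norm_num) hmom.ne⟩)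
  set M := Me.toReal with hM
  have hMM : ENNReal.ofReal M = Me := ENNReal.ofReal_toReal hMtop
  have hMnn : 0 ≤ M := ENNReal.toReal_nonneg
  have hmoment : ∀ h : ℝ → ℝ, IsDecayDensity α A h → (∀ᵐ u, h u ≤ 2 * h₀ u) →
      ∫⁻ x, ENNReal.ofReal (|x| ^ q * gaussSmooth h x) ≤ ENNReal.ofReal M := by
    intro h hh hle
    rw [hMM]
    refine (lintegral_abs_rpow_gaussSmooth_le (by linarith) hh.measurable hh.nonneg
      hh.lintegral_eq).trans ?_
    rw [hMe]
    gcongr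
    rw [hm₀, ← lintegral_const_mul' _ _ (by norm_num)]
    refine lintegral_mono_ae (hle.mono fun u hu => ?_)
    rw [← ENNReal.ofReal_ofNat, ← ENNReal.ofReal_mul (by norm_num)]
    apply ENNReal.ofReal_le_ofReal
    calc |u| ^ q * h u ≤ |u| ^ q * (2 * h₀ u) := by gcongr
      _ = _ := by ring
  -- As `e₁ ≤ 2 η n^{-β}`, the first term keeps the proportions below `ε₀ n^{-β}` and the second
  -- keeps the `q`-th moment of the mixtures below `A ^ q`.
  set η := min (ε₀ / 2) ((A ^ q - absMoment q) / (2 * (M + 1))) with hη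
  have hη0 : 0 < η := by rw [hη]; positivity
  have hηε : 2 * η ≤ ε₀ := by
    have : η ≤ ε₀ / 2 := min_le_left _ _
    linarith
  have hηM : 2 * η * M ≤ A ^ q - absMoment q := by
    have : η ≤ (A ^ q - absMoment q) / (2 * (M + 1)) := min_le_right _ _
    rw [le_div_iff₀ (by positivity)] at this
    nlinarith
  refine ⟨η ^ 2 * θ ^ 2 * 16 ^ (-α) / 16, by positivity, ?_⟩
  filter_upwards [eventually_ge_atTop 3,
    tendsto_natCast_atTop_atTop.eventually_ge_atTop (8 * B + 4 * A ^ q + 1)] with n hn3 hnB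
  have hAq : 0 < A ^ q := by positivity
  have hn : (1 : ℝ) ≤ n := by linarith
  have hn0 : (0 : ℝ) < n := by linarith
  have hlog : 1 ≤ Real.log n := by
    rw [Real.le_log_iff_exp_le hn0]
    have h3 : (3 : ℝ) ≤ n := by exact_mod_cast hn3
    linarith [Real.exp_one_lt_three]
  -- The factor `4` makes `e^{-τ²/4} = n^{-4}`; `τ ≥ 1` follows from `log n ≥ 1`, which is why `n ≥
  -- 3` is required.
  set τ : ℝ := 4 * √(Real.log n) with hτdef
  have hsq : 1 ≤ √(Real.log n) := Real.one_le_sqrt.2 hlog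
  have hτ : 1 ≤ τ := by rw [hτdef]; linarith
  have hτ0 : 0 < τ := by linarith
  have hτ2 : τ ^ 2 = 16 * Real.log n := by
    rw [hτdef, mul_pow, Real.sq_sqrt (by linarith)]; norm_num
  have hexp : Real.exp (-(τ ^ 2 / 4)) = ((n : ℝ) ^ 4)⁻¹ := by
    have e : -(τ ^ 2 / 4) = -((4 : ℕ) * Real.log n) := by rw [hτ2]; push_cast; ring
    rw [e, Real.exp_neg, Real.exp_nat_mul, Real.exp_log hn0]
  obtain ⟨h₁, hh₁, hle, hsm⟩ := hpert τ hτ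
  rw [hexp] at hsm
  obtain ⟨s, hs⟩ : ∃ s : ℝ, s = θ * τ ^ (-α) := ⟨_, rfl⟩
  rw [← hs] at hsm
  have hs0 : 0 < s := by rw [hs]; positivity
  have hs1 : s ≤ 1 := by
    rw [hs]
    exact mul_le_one₀ hθ1 (by positivity) (Real.rpow_le_one_of_one_le_of_nonpos hτ (by linarith))
  set p : ℝ := (n : ℝ) ^ (-β) with hp
  have hp0 : 0 < p := by positivity
  have hp1 : p ≤ 1 := Real.rpow_le_one_of_one_le_of_nonpos hn (by linarith)
  set e₀ := η * p with he₀
  -- This factor undoes the normalisation of `h₁`, so that the extra mass `e₀ s` in the alternative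
  -- offsets the loss `e₀ s φ` in the null component.
  set e₁ := e₀ * (1 + s) with he₁
  have he₀0 : 0 < e₀ := by positivity
  have he₀₁ : e₀ ≤ e₁ := by rw [he₁]; nlinarith
  have he₁2 : e₁ ≤ 2 * η * p := by rw [he₁, he₀]; nlinarith [mul_pos hη0 hp0]
  have he₁ε : e₁ ≤ ε₀ * p := he₁2.trans (mul_le_mul_of_nonneg_right hηε hp0.le)
  have he₁η : e₁ ≤ 2 * η := he₁2.trans (mul_le_of_le_one_right (by positivity) hp1)
  have he₁1 : e₁ ≤ 1 := by linarith
  have hmemε : ∀ e, e ≤ e₁ → absMoment q + e * M ≤ A ^ q := by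
    intro e he
    have : e * M ≤ 2 * η * M := mul_le_mul_of_nonneg_right (he.trans he₁η) hMnn
    linarith
  have hmem₀ : (e₀, mixtureDensity e₀ (unitMixingLaw h₀)) ∈ paramSpace α β ε₀ q A T d n :=
    hh₀.mem_paramSpace hq0 he₀0.le (he₀₁.trans he₁ε)
      (hmoment h₀ hh₀ (ae_of_all _ fun u => by linarith [hh₀.nonneg u])) (hmemε _ he₀₁) hMnn T d
  have hmem₁ : (e₁, mixtureDensity e₁ (unitMixingLaw h₁)) ∈ paramSpace α β ε₀ q A T d n :=
    hh₁.mem_paramSpace hq0 (he₀0.le.trans he₀₁) he₁ε (hmoment h₁ hh₁ hle) (hmemε _ le_rfl) hMnn T d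
  have hmeas : ∀ (h : ℝ → ℝ) (e : ℝ), IsDecayDensity α A h →
      Measurable (mixtureDensity e (unitMixingLaw h)) := by
    intro h e hh
    rw [funext (hh.mixtureDensity_eq e)]
    exact (measurable_stdPhi.const_mul _).add ((measurable_gaussSmooth hh.measurable).const_mul _)
  have hone₀ := hh₀.isMixingLaw.lintegral_mixtureDensity he₀0.le (he₀₁.trans he₁1)
  have hone₁ := hh₁.isMixingLaw.lintegral_mixtureDensity (he₀0.le.trans he₀₁) he₁1
  have hclose : ∀ x, |mixtureDensity e₁ (unitMixingLaw h₁) x -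
      mixtureDensity e₀ (unitMixingLaw h₀) x| ≤ B * ((n : ℝ) ^ 4)⁻¹ := by
    intro x
    have e : mixtureDensity e₁ (unitMixingLaw h₁) x - mixtureDensity e₀ (unitMixingLaw h₀) x =
        e₀ * ((1 + s) * gaussSmooth h₁ x - gaussSmooth h₀ x - s * stdPhi x) := by
      rw [hh₁.mixtureDensity_eq, hh₀.mixtureDensity_eq, he₁]; ring
    rw [e, abs_mul, abs_of_pos he₀0]
    exact (mul_le_of_le_one_left (abs_nonneg _) (he₀₁.trans he₁1)).trans (hsm x)
  -- The tail bound is the moment constraint of the class itself, taken from the membership of the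
  -- first point.
  have haff := one_sub_le_lintegral_min (B := A ^ q) (R := n) hq0 hAq.le hn0 (by positivity)
    (hmeas h₀ e₀ hh₀) (hmeas h₁ e₁ hh₁)
    (hh₀.isMixingLaw.mixtureDensity_nonneg he₀0.le (he₀₁.trans he₁1))
    (hh₁.isMixingLaw.mixtureDensity_nonneg (he₀0.le.trans he₀₁) he₁1) hone₀ hmem₀.2.2.2 hclose
  have hsmall := affinity_defect_le hq hB.le hAq.le hnB
  have hfinal := le_minimaxRisk_of_two_points (n := n) (by omega) hmem₀ hmem₁
    (by rw [hone₀]; exact ENNReal.one_ne_top) (by rw [hone₁]; exact ENNReal.one_ne_top)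
    ((ENNReal.ofReal_le_ofReal (by linarith)).trans haff)
  refine le_trans (le_of_eq ?_) hfinal
  congr 1
  have hp2 : p ^ 2 = (n : ℝ) ^ (-2 * β) := by
    rw [hp, ← Real.rpow_natCast, ← Real.rpow_mul hn0.le]; congr 1; push_cast; ring
  have hτα : (τ ^ (-α)) ^ 2 = 16 ^ (-α) * Real.log n ^ (-α) := by
    rw [← Real.mul_rpow (by norm_num) (by linarith), ← hτ2, ← Real.rpow_natCast,
      ← Real.rpow_natCast, ← Real.rpow_mul hτ0.le, ← Real.rpow_mul hτ0.le]
    congr 1; push_cast; ring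
  have e : e₁ - e₀ = η * p * (θ * τ ^ (-α)) := by rw [he₁, ← hs, he₀]; ring
  rw [e, rate, ← hp2]
  linear_combination (-(η ^ 2 * θ ^ 2 * p ^ 2) / 16) * hτα

/-! ### Attainment of the rate -/

/-- In the regime `γ < 1/2 - β` the variance term is dominated by the rate. -/
theorem eventually_rpow_le_rate {γ α β : ℝ} (h : γ < 1 / 2 - β) :
    ∀ᶠ n : ℕ in atTop, (n : ℝ) ^ (2 * γ - 1) ≤ rate α β n := by
  -- The spare power of `n` absorbs `(log n)^α`.
  have hδ : 0 < 1 - 2 * β - 2 * γ := by linarith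
  have hlo := (isLittleO_log_rpow_rpow_atTop α hδ).bound one_pos
  filter_upwards [tendsto_natCast_atTop_atTop.eventually hlo, eventually_ge_atTop 2] with n hn h2
  have hn1 : (1 : ℝ) < n := by exact_mod_cast h2
  have hn0 : (0 : ℝ) < n := by linarith
  have hlog : 0 < Real.log n := Real.log_pos hn1
  rw [Real.norm_of_nonneg (by positivity), Real.norm_of_nonneg (by positivity), one_mul] at hn
  rw [rate, Real.rpow_neg hlog.le, ← div_eq_mul_inv, le_div_iff₀ (by positivity)]
  calc (n : ℝ) ^ (2 * γ - 1) * Real.log n ^ α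
      ≤ (n : ℝ) ^ (2 * γ - 1) * (n : ℝ) ^ (1 - 2 * β - 2 * γ) := by gcongr
    _ = (n : ℝ) ^ (-2 * β) := by rw [← Real.rpow_add hn0]; congr 1; ring

end ProportionEstimation

end

theorem theorem3p1 (γ α β ε₀ q A : ℝ) (hγ0 : 0 < γ) (hγ1 : γ < 1 / 2) (hα : 0 < α)
    (hβ0 : 0 ≤ β) (hβ1 : β < 1 / 2) (hε0 : 0 < ε₀) (hε1 : ε₀ < 1) (hq : 2 ≤ q)
    (hA : Real.sqrt 2 * ProportionEstimation.absMoment q ^ (1 / q) < A)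
    (T : ℝ → ℝ) (d : Bool) :
    (∃ c : ℝ, 0 < c ∧ ∀ᶠ n : ℕ in Filter.atTop,
      ENNReal.ofReal (c * ProportionEstimation.rate α β n) ≤
        ProportionEstimation.minimaxRisk n
          (ProportionEstimation.paramSpace α β ε₀ q A T d n)) ∧
    (∃ C : ℝ, 0 < C ∧ ∀ᶠ n : ℕ in Filter.atTop,
      ProportionEstimation.maxRisk (ProportionEstimation.propEstimator γ n)
          (ProportionEstimation.paramSpace α β ε₀ q A T d n) ≤
        ENNReal.ofReal (C * (ProportionEstimation.rate α β n + (n : ℝ) ^ (2 * γ - 1)))) ∧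
    (γ < 1 / 2 - β → ∃ K : ℝ, 0 < K ∧ ∀ᶠ n : ℕ in Filter.atTop,
      ProportionEstimation.maxRisk (ProportionEstimation.propEstimator γ n)
          (ProportionEstimation.paramSpace α β ε₀ q A T d n) ≤
        ENNReal.ofReal (K * ProportionEstimation.rate α β n) ∧
      ProportionEstimation.maxRisk (ProportionEstimation.propEstimator γ n)
          (ProportionEstimation.paramSpace α β ε₀ q A T d n) ≤
        ENNReal.ofReal K * ProportionEstimation.minimaxRisk n
          (ProportionEstimation.paramSpace α β ε₀ q A T d n)) := by
  have hA0 : 0 < A := lt_of_le_of_lt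
    (mul_nonneg (Real.sqrt_nonneg 2)
      (Real.rpow_nonneg (ProportionEstimation.absMoment_nonneg q) _)) hA
  obtain ⟨c, hc, hlow⟩ :=
    ProportionEstimation.exists_le_minimaxRisk (β := β) hα hβ0 hε0 hε1 hq hA T d
  obtain ⟨C, hC, hup⟩ := ProportionEstimation.exists_maxRisk_propEstimator_le
    (α := α) (q := q) hγ0 hβ0 hε0 hε1 hA0 T d
  refine ⟨⟨c, hc, hlow⟩, ⟨C, hC, hup⟩, fun hγβ => ?_⟩
  -- `2 * C` bounds the risk by the rate, since the variance term is at most the rate; `2 * C / c`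
  -- converts the rate into the minimax risk through the lower bound.
  refine ⟨2 * C + 2 * C / c, by positivity, ?_⟩
  filter_upwards [hlow, hup, ProportionEstimation.eventually_rpow_le_rate (α := α) hγβ,
    Filter.eventually_ge_atTop 1] with n h1 h2 h3 hn
  have hr : 0 ≤ ProportionEstimation.rate α β n := by
    have := Real.log_nonneg (by exact_mod_cast hn : (1 : ℝ) ≤ n)
    rw [ProportionEstimation.rate]; positivity
  have hCc : 0 < 2 * C / c := by positivity
  have h4 : C * (ProportionEstimation.rate α β n + (n : ℝ) ^ (2 * γ - 1)) ≤
      2 * C * ProportionEstimation.rate α β n := by nlinarith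
  refine ⟨h2.trans (ENNReal.ofReal_le_ofReal (h4.trans ?_)), h2.trans ?_⟩
  · nlinarith [mul_nonneg hCc.le hr]
  · calc ENNReal.ofReal (C * (ProportionEstimation.rate α β n + (n : ℝ) ^ (2 * γ - 1)))
        ≤ ENNReal.ofReal (2 * C / c * (c * ProportionEstimation.rate α β n)) := by
          refine ENNReal.ofReal_le_ofReal (h4.trans (le_of_eq ?_))
          field_simp
      _ = ENNReal.ofReal (2 * C / c) * ENNReal.ofReal (c * ProportionEstimation.rate α β n) :=
          ENNReal.ofReal_mul hCc.le
      _ ≤ _ := by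
          gcongr
          linarith
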